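/- Let $d\ge 2$, $n=d+2$, $0<\alpha<n$, $1<q\le n/\alpha$ and $q'=q/(q-1)$. Let $\Omega$ be either $\mathbb{R}^{d+1}$ or the half-space $\mathbb{R}^{d}\times(0,\infty)$. **Lattice.** A time-backward rectangle of side $\ell_R=\ell$ is $R=Q(x,\ell)\times(t-\ell^2,t]$, where $Q(x,\ell)=\prod_{i=1}^d[x_i-\ell/2,x_i+\ell/2)$. Its children are the $2^{d}\cdot 4$ rectangles of side $\ell/2$ obtained by halving the sides of $Q$ and cutting the time interval into four equal pieces. $\mathfrak{D}(R)$ consists of $R$ and its iterated children, and $\delta_3R$ is the concentric box with spatial sides $3\ell$ and duration $9\ell^2$. Let $\mathscr{D}$ be a parabolic dyadic lattice in $\Omega$: a collection of time-backward rectangles contained in $\Omega$ such that (i) $\mathfrak{D}(R)\subset\mathscr{D}$ for all $R\in\mathscr{D}$; (ii) any two elements of $\mathscr{D}$ belong to $\mathfrak{D}(R)$ for some $R\in\mathscr{D}$; (iii) each compact subset of $\Omega$ is contained in some $R\in\mathscr{D}$. For every $R\in\mathscr{D}$ let $\eta_R\in C_c^\infty(\mathbb{R}^{d+1})$ satisfy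 $\mathbf 1_R\le\eta_R\le\mathbf 1_{\delta_3R}$. **Potential, energy, capacity.** For a positive Radon measure $\mu$ on $\mathbb{R}^{d+1}$ put $\mu(\eta_R)=\int\eta_R\,d\mu$ and $$\mathcal{W}^{\mathcal D}\mu=\sum_{R\in\mathscr{D},\ \ell_R<1}\bigl(\ell_R^{\alpha q-n}\mu(\eta_R)\bigr)^{q'-1}\eta_R\in[0,\infty],\qquad \mathcal{E}\mu=\int\mathcal{W}^{\mathcal D}\mu\,d\mu .$$ For $K\subset\mathbb{R}^{d+1}$ compact let $$\mathscr{C}_{\alpha,q}(K)^{1/q}=\sup\{\|\mu\|:\mu\text{ a positive Radon measure},\ \mu(K^c)=0,\ \mathcal{E}\mu\le 1\}\in[0,\infty].$$ For $G$ open the capacity is the supremum of $\mathscr{C}_{\alpha,q}(K)$ over compact $K\subset G$, and for an arbitrary set $E$ it is the infimum of $\mathscr{C}_{\alpha,q}(G)$ over open $G\supset E$. When $0<\mathscr{C}_{\alpha,q}(E)<\infty$, a $\mathscr{C}_{\alpha,q}$-capacitary measure for $E$ is a positive Radon measure $\gamma$ with $\operatorname{spt}\gamma\subset\overline{E}$ such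 that (a) $\gamma(\overline{E})=\mathscr{C}_{\alpha,q}(E)$; (b) the set of points of $E$ at which $\mathcal{W}^{\mathcal D}\gamma\ge1$ fails has capacity zero; (c) $\mathcal{W}^{\mathcal D}\gamma\le1$ at every point of $\operatorname{spt}\gamma$. **Theorem.** 1. Every compact $K\subset\mathbb{R}^{d+1}$ with $0<\mathscr{C}_{\alpha,q}(K)<\infty$ admits a $\mathscr{C}_{\alpha,q}$-capacitary measure $\gamma^K$. In particular $\operatorname{spt}\gamma^K\subset K$ and $\gamma^K(K)=\mathscr{C}_{\alpha,q}(K)$, where $\mathscr{C}_{\alpha,q}(K)$ may be taken in either sense (as defined for compact sets or as defined for arbitrary sets). 2. Every set $E\subset\mathbb{R}^{d+1}$ with $0<\mathscr{C}_{\alpha,q}(E)<\infty$ admits a $\mathscr{C}_{\alpha,q}$-capacitary measure $\gamma^E$. -/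

import Mathlib

open MeasureTheory Set
open scoped ENNReal ContDiff

noncomputable section

namespace Parabolic

/-- Space-time `ℝ^d × ℝ`, with points `(x, t)`. -/
abbrev SpaceTime (d : ℕ) : Type := EuclideanSpace ℝ (Fin d) × ℝ

/-- The data of a time-backward parabolic rectangle: the centre of the spatial cube, the final
time, and the side length. -/
structure Rect (d : ℕ) where
  /-- centre of the spatial cube -/
  x : EuclideanSpace ℝ (Fin d)
  /-- final time -/
  t : ℝ
  /-- side length of the spatial cube; the duration is its square -/
  side : ℝ
  side_pos : 0 < side

namespace Rect

variable {d : ℕ}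

/-- The time-backward rectangle `Q(x, ℓ) × (t - ℓ², t]`. Half-open sides are taken so that the
children of a rectangle partition it exactly. (A continuous function that is at least `1` on the
open rectangle is at least `1` on this one too.) -/
def carrier (R : Rect d) : Set (SpaceTime d) :=
  {z | (∀ i, R.x i - R.side / 2 ≤ z.1 i ∧ z.1 i < R.x i + R.side / 2) ∧
    R.t - R.side ^ 2 < z.2 ∧ z.2 ≤ R.t}

/-- The concentric dilate `δ_c R`: the lengths in space are multiplied by `c`, the duration by
`c²`, and the centre `(x, t - ℓ² / 2)` is kept. -/
def dilate (c : ℝ) (R : Rect d) : Set (SpaceTime d) :=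
  {z | (∀ i, R.x i - c * R.side / 2 ≤ z.1 i ∧ z.1 i < R.x i + c * R.side / 2) ∧
    (R.t - R.side ^ 2 / 2) - c ^ 2 * R.side ^ 2 / 2 < z.2 ∧
    z.2 ≤ (R.t - R.side ^ 2 / 2) + c ^ 2 * R.side ^ 2 / 2}

/-- `R'` is one of the `2 ^ d * 4` children of `R`: each side of the spatial cube is halved and
the time interval is cut into four equal pieces. -/
def IsChild (R R' : Rect d) : Prop :=
  R'.side = R.side / 2 ∧
  (∀ i, R'.x i = R.x i - R.side / 4 ∨ R'.x i = R.x i + R.side / 4) ∧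
  ∃ k : Fin 4, R'.t = R.t - (k : ℕ) * (R.side ^ 2 / 4)

/-- The family `𝔇(R)` of dyadic descendants of `R`, including `R` itself. -/
def descendants (R : Rect d) : Set (Rect d) :=
  {R' | Relation.ReflTransGen IsChild R R'}

end Rect

/-- A parabolic dyadic lattice in the region `Ω` of space-time, in the sense of Lerner and
Nazarov. -/
structure IsDyadicLattice {d : ℕ} (Ω : Set (SpaceTime d)) (D : Set (Rect d)) : Prop where
  subset_region : ∀ R ∈ D, R.carrier ⊆ Ω
  descendants_subset : ∀ R ∈ D, R.descendants ⊆ D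
  common_ancestor : ∀ R₁ ∈ D, ∀ R₂ ∈ D, ∃ R ∈ D, R₁ ∈ R.descendants ∧ R₂ ∈ R.descendants
  exhausts : ∀ K : Set (SpaceTime d), IsCompact K → K ⊆ Ω → ∃ R ∈ D, K ⊆ R.carrier

/-- A choice of smooth cut-off functions `1_R ≤ η_R ≤ 1_{δ₃R}`, one for each rectangle of the
lattice. -/
structure IsCutoffFamily {d : ℕ} (D : Set (Rect d)) (η : Rect d → SpaceTime d → ℝ) : Prop where
  contDiff : ∀ R ∈ D, ContDiff ℝ ∞ (η R)
  hasCompactSupport : ∀ R ∈ D, HasCompactSupport (η R)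
  indicator_le : ∀ R ∈ D, ∀ z, R.carrier.indicator (fun _ => (1 : ℝ)) z ≤ η R z
  le_indicator : ∀ R ∈ D, ∀ z, η R z ≤ (R.dilate 3).indicator (fun _ => (1 : ℝ)) z

section Potential

variable {d : ℕ} (D : Set (Rect d)) (η : Rect d → SpaceTime d → ℝ) (α q : ℝ)

/-- The regularized parabolic dyadic Wolff potential
`∑_{R ∈ D, ℓ_R < 1} (ℓ_R ^ (αq - n) * μ(η_R)) ^ (q' - 1) * η_R(z)`, where `n = d + 2` and
`q' = q / (q - 1)`, with values in `[0, ∞]`. -/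
def wolffPotential (μ : Measure (SpaceTime d)) (z : SpaceTime d) : ℝ≥0∞ :=
  ∑' R : {R : Rect d // R ∈ D ∧ R.side < 1},
    (ENNReal.ofReal (R.1.side ^ (α * q - ((d : ℝ) + 2))) *
        ∫⁻ w, ENNReal.ofReal (η R.1 w) ∂μ) ^ (q / (q - 1) - 1) *
      ENNReal.ofReal (η R.1 z)

/-- The regularized dyadic energy `∫ 𝒲μ dμ`. -/
def energy (μ : Measure (SpaceTime d)) : ℝ≥0∞ :=
  ∫⁻ z, wolffPotential D η α q μ z ∂μ

/-- The parabolic dyadic Bessel capacity of a compact set `K`: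
`𝒞(K) ^ (1 / q) = sup {‖μ‖ : μ a positive Radon measure, μ(Kᶜ) = 0, energy at most 1}`. -/
def compactCapacity (K : Set (SpaceTime d)) : ℝ≥0∞ :=
  (⨆ (μ : Measure (SpaceTime d)) (_ : IsLocallyFiniteMeasure μ) (_ : μ Kᶜ = 0)
    (_ : energy D η α q μ ≤ 1), μ univ) ^ q

/-- The capacity of an arbitrary set: inner regular on open sets, then outer regular. -/
def capacity (E : Set (SpaceTime d)) : ℝ≥0∞ :=
  ⨅ (G : Set (SpaceTime d)) (_ : IsOpen G) (_ : E ⊆ G),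
    ⨆ (K : Set (SpaceTime d)) (_ : IsCompact K) (_ : K ⊆ G), compactCapacity D η α q K

/-- `γ` is a capacitary measure for `E`: a positive Radon measure supported in the closure of `E`,
of mass `𝒞(E)`, whose Wolff potential is at least `1` on `E` outside a set of capacity zero and
at most `1` everywhere on the support of `γ`. -/
structure IsCapacitaryMeasure (E : Set (SpaceTime d)) (γ : Measure (SpaceTime d)) : Prop where
  isLocallyFinite : IsLocallyFiniteMeasure γ
  support_subset : γ.support ⊆ closure E
  mass_eq : γ (closure E) = capacity D η α q E
  one_le_quasi_everywhere : capacity D η α q {z ∈ E | ¬ 1 ≤ wolffPotential D η α q γ z} = 0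
  le_one_on_support : ∀ z ∈ γ.support, wolffPotential D η α q γ z ≤ 1

end Potential

end Parabolic

end

/-! With $r=q'$, normalize the cut-offs to kernels $G_R=\ell_R^{(\alpha q-n)/q}\eta_R$. The Wolff
potential becomes $\sum_R\mu(G_R)^{r-1}G_R$ and its energy $\sum_R\mu(G_R)^r$. The problem is then a
duality between $\ell^r$ (the coefficients of measures) and $\ell^q$ (nonnegative sequences $f$ with
potential $\sum f_RG_R$). The only facts used about the kernels are that they are countably many,
continuous, nonnegative and compactly supported.

Compact sets. Vague compactness gives a measure $\mu$ of maximal mass $M$ among those of energy at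
most $1$. Perturbing $\mu$ to $\mu+s\nu$ gives $\nu(K)/M\le\int\mathcal W\mu\,d\nu$
(`div_maxMass_le_lintegral_pot`). Hence $\mathcal W\mu\ge 1/M$ quasi-everywhere on $K$, and equality
holds $\mu$-a.e. because the energy is at most $1$. Lower semicontinuity makes $1/M$ an upper bound
on the support, and $M^{q-1}\mu$ is capacitary.

General sets. An open set is exhausted by compact sets, and an arbitrary set is approached by open
supersets. Both limits are taken in `exists_isEquilibrium_limit`. The sequences $f_n=\mu_n(G)^{r-1}$
have $q$-th power norms tending to the limiting capacity, and their midpoints are still admissible,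
so uniform convexity of $\ell^q$ (`tendsto_tsum_sub_rpow`) gives strong convergence. A capacitary
Chebyshev inequality (`mul_rootCap_lt_synth_le`) then carries the lower bound to the limit
quasi-everywhere. The upper bound on the support survives vague convergence alone
(`VagueTendsto.pot_le`). -/

namespace WolffCapacity

open Filter Topology

set_option linter.unusedSectionVars false

/-! ### Vague compactness of measures of bounded mass -/

variable {X : Type*} [MetricSpace X] [ProperSpace X] [MeasurableSpace X] [BorelSpace X]

/-- Vague convergence, tested on nonnegative continuous functions with compact support. -/
def VagueTendsto (μ : ℕ → Measure X) (l : Filter ℕ) (γ : Measure X) : Prop :=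
  ∀ φ : X → ℝ, Continuous φ → HasCompactSupport φ → (∀ x, 0 ≤ φ x) →
    Tendsto (fun n => ∫⁻ x, ENNReal.ofReal (φ x) ∂(μ n)) l (𝓝 (∫⁻ x, ENNReal.ofReal (φ x) ∂γ))

-- Along an ultrafilter every bounded sequence of integrals converges, so no diagonal subsequence is
-- needed; the limits form a positive functional, which Riesz represents.
open CompactlySupported in
theorem exists_vagueTendsto (μ : ℕ → Measure X) (U : Ultrafilter ℕ) (M : ℝ≥0∞) (hM : M ≠ ⊤)
    (hμ : ∀ n, μ n univ ≤ M) :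
    ∃ γ : Measure X, γ.Regular ∧ VagueTendsto μ U γ := by
  have hfin : ∀ n, IsFiniteMeasure (μ n) := fun n => ⟨(hμ n).trans_lt hM.lt_top⟩
  have hint : ∀ (φ : C_c(X, ℝ)) n, Integrable φ (μ n) := fun φ n =>
    φ.continuous.integrable_of_hasCompactSupport φ.hasCompactSupport
  have hlim : ∀ φ : C_c(X, ℝ), ∃ a, Tendsto (fun n => ∫ x, φ x ∂(μ n)) U (𝓝 a) := by
    intro φ
    obtain ⟨C, hC⟩ := φ.hasCompactSupport.exists_bound_of_continuous φ.continuous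
    have hb : ∀ n, ‖∫ x, φ x ∂(μ n)‖ ≤ |C| * M.toReal := by
      intro n
      refine (norm_integral_le_of_norm_le_const
        (Eventually.of_forall fun x => (hC x).trans (le_abs_self C))).trans ?_
      refine mul_le_mul_of_nonneg_left ?_ (abs_nonneg _)
      exact ENNReal.toReal_mono hM (hμ n)
    obtain ⟨a, -, ha⟩ := (isCompact_closedBall (0 : ℝ) (|C| * M.toReal)).ultrafilter_le_nhds
      (U.map fun n => ∫ x, φ x ∂(μ n)) (by
        simp only [Ultrafilter.coe_map, le_principal_iff, mem_map]
        exact univ_mem' fun n => by simpa using hb n)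
    exact ⟨a, ha⟩
  choose Λ hΛ using hlim
  let L : C_c(X, ℝ) →ₗ[ℝ] ℝ :=
    { toFun := Λ
      map_add' := fun φ ψ => by
        refine tendsto_nhds_unique (hΛ (φ + ψ)) ?_
        refine ((hΛ φ).add (hΛ ψ)).congr fun n => ?_
        rw [← integral_add (hint φ n) (hint ψ n)]; rfl
      map_smul' := fun c φ => by
        refine tendsto_nhds_unique (hΛ (c • φ)) ?_
        refine ((hΛ φ).const_mul c).congr fun n => ?_
        rw [← integral_const_mul]; rfl }
  let P : C_c(X, ℝ) →ₚ[ℝ] ℝ := PositiveLinearMap.mk₀ L fun φ hφ =>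
    ge_of_tendsto' (hΛ φ) fun n => integral_nonneg fun x => hφ x
  refine ⟨RealRMK.rieszMeasure P, inferInstance, fun φ hc hs h0 => ?_⟩
  let ψ : C_c(X, ℝ) := ⟨⟨φ, hc⟩, hs⟩
  have h1 := RealRMK.integral_rieszMeasure P ψ
  have h2 : Tendsto (fun n => ∫ x, φ x ∂(μ n)) U (𝓝 (∫ x, φ x ∂(RealRMK.rieszMeasure P))) := by
    have : ∫ x, φ x ∂(RealRMK.rieszMeasure P) = Λ ψ := h1
    rw [this]; exact hΛ ψ
  have h3 := ENNReal.tendsto_ofReal h2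
  rw [ofReal_integral_eq_lintegral_ofReal (hc.integrable_of_hasCompactSupport hs)
    (Eventually.of_forall h0)] at h3
  refine h3.congr fun n => ?_
  rw [ofReal_integral_eq_lintegral_ofReal (hc.integrable_of_hasCompactSupport hs)
    (Eventually.of_forall h0)]

theorem exists_cutoff {K V : Set X} (hK : IsCompact K) (hV : IsOpen V) (hKV : K ⊆ V) :
    ∃ φ : X → ℝ, Continuous φ ∧ HasCompactSupport φ ∧ (∀ x, 0 ≤ φ x) ∧
      (∀ x ∈ K, φ x = 1) ∧ ∀ x, ENNReal.ofReal (φ x) ≤ V.indicator 1 x := by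
  obtain ⟨φ, h1, h0, hs, hI⟩ :=
    exists_continuous_one_zero_of_isCompact hK hV.isClosed_compl (disjoint_compl_right_iff_subset.2 hKV)
  refine ⟨φ, φ.continuous, hs, fun x => (hI x).1, fun x hx => h1 hx, fun x => ?_⟩
  by_cases hx : x ∈ V
  · simpa [hx] using (hI x).2
  · simp [hx, h0 (show x ∈ Vᶜ from hx)]

/-- A vague limit does not gain mass on open sets. -/
theorem VagueTendsto.measure_le {μ : ℕ → Measure X} {U : Ultrafilter ℕ} {γ : Measure X}
    [γ.Regular] (h : VagueTendsto μ U γ) {V : Set X} (hV : IsOpen V) {a : ℝ≥0∞}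
    (ha : ∀ᶠ n in (U : Filter ℕ), μ n V ≤ a) : γ V ≤ a := by
  rw [hV.measure_eq_iSup_isCompact]
  refine iSup₂_le fun K hKV => iSup_le fun hK => ?_
  obtain ⟨φ, hc, hs, h0, h1, hle⟩ := exists_cutoff hK hV hKV
  have hγ : γ K ≤ ∫⁻ x, ENNReal.ofReal (φ x) ∂γ := by
    rw [← lintegral_indicator_one hK.measurableSet]
    refine lintegral_mono fun x => ?_
    by_cases hx : x ∈ K
    · simp [hx, h1 x hx]
    · simp [hx]
  refine hγ.trans (le_of_tendsto (h φ hc hs h0) (ha.mono fun n hn => le_trans ?_ hn))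
  rw [← lintegral_indicator_one hV.measurableSet]
  exact lintegral_mono hle

/-- No mass is lost in a vague limit of measures that live on one compact set. -/
theorem VagueTendsto.measure_univ {μ : ℕ → Measure X} {U : Ultrafilter ℕ} {γ : Measure X}
    [γ.Regular] (h : VagueTendsto μ U γ) {K : Set X} (hK : IsCompact K)
    (hμ : ∀ n, μ n Kᶜ = 0) {a : ℝ≥0∞}
    (ha : Tendsto (fun n => μ n univ) U (𝓝 a)) : γ univ = a := by
  obtain ⟨φ, hc, hs, h0, h1, -⟩ := exists_cutoff hK isOpen_univ (subset_univ K)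
  have key : ∀ ν : Measure X, ν Kᶜ = 0 → ∫⁻ x, ENNReal.ofReal (φ x) ∂ν = ν univ := by
    intro ν hν
    rw [← lintegral_one]
    refine lintegral_congr_ae ?_
    filter_upwards [show ∀ᵐ x ∂ν, x ∈ K from hν] with x hx
    simp [h1 x hx]
  have hγ : γ Kᶜ = 0 := le_antisymm
    (h.measure_le hK.isClosed.isOpen_compl (Eventually.of_forall fun n => (hμ n).le)) bot_le
  have := h φ hc hs h0
  rw [key γ hγ] at this
  exact tendsto_nhds_unique this (ha.congr fun n => (key _ (hμ n)).symm)

theorem exists_mem_support {ν : Measure X} {V : Set X} (h : 0 < ν V) :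
    ∃ z ∈ V, z ∈ ν.support := by
  obtain ⟨z, hz⟩ := Measure.nonempty_inter_support_of_pos h
  exact ⟨z, by tauto⟩

theorem VagueTendsto.eventually_measure_pos {μ : ℕ → Measure X} {U : Ultrafilter ℕ} {γ : Measure X}
    [γ.Regular] (h : VagueTendsto μ U γ) {V : Set X} (hV : IsOpen V) (hp : 0 < γ V) :
    ∀ᶠ n in (U : Filter ℕ), 0 < μ n V := by
  by_contra hcon
  have := h.measure_le hV (a := 0) ((Ultrafilter.eventually_not.2 hcon).mono fun n hn => not_lt.1 hn)
  exact absurd hp (not_lt.2 this)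

/-! ### Abstract kernels, potentials and capacities -/

variable {ι : Type*} [Countable ι]

/-- A family of nonnegative continuous kernels with compact support. -/
structure IsKernelFamily (G : ι → X → ℝ) : Prop where
  continuous : ∀ i, Continuous (G i)
  hasCompactSupport : ∀ i, HasCompactSupport (G i)
  nonneg : ∀ i x, 0 ≤ G i x

/-- The coefficients `μ(G i)`. -/
noncomputable def coeff (G : ι → X → ℝ) (μ : Measure X) (i : ι) : ℝ≥0∞ :=
  ∫⁻ w, ENNReal.ofReal (G i w) ∂μ

/-- The sum `∑ f i * G i`. -/
noncomputable def synth (G : ι → X → ℝ) (f : ι → ℝ≥0∞) (z : X) : ℝ≥0∞ :=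
  ∑' i, f i * ENNReal.ofReal (G i z)

/-- The nonlinear potential `∑ μ(G i) ^ (r - 1) * G i`. -/
noncomputable def pot (G : ι → X → ℝ) (r : ℝ) (μ : Measure X) : X → ℝ≥0∞ :=
  synth G fun i => coeff G μ i ^ (r - 1)

/-- The energy of the nonlinear potential. -/
noncomputable def energy (G : ι → X → ℝ) (r : ℝ) (μ : Measure X) : ℝ≥0∞ :=
  ∫⁻ z, pot G r μ z ∂μ

/-- The largest mass of a measure on `K` of energy at most `1`. -/
noncomputable def maxMass (G : ι → X → ℝ) (r : ℝ) (K : Set X) : ℝ≥0∞ :=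
  ⨆ (μ : Measure X) (_ : IsLocallyFiniteMeasure μ) (_ : μ Kᶜ = 0) (_ : energy G r μ ≤ 1), μ univ

/-- The supremum of `maxMass` over compact subsets. -/
noncomputable def innerMass (G : ι → X → ℝ) (r : ℝ) (V : Set X) : ℝ≥0∞ :=
  ⨆ (K : Set X) (_ : IsCompact K) (_ : K ⊆ V), maxMass G r K

/-- The root of the capacity of an arbitrary set. -/
noncomputable def rootCap (G : ι → X → ℝ) (r : ℝ) (E : Set X) : ℝ≥0∞ :=
  ⨅ (V : Set X) (_ : IsOpen V) (_ : E ⊆ V), innerMass G r V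

variable {G : ι → X → ℝ} {r q : ℝ}

section Potential

theorem IsKernelFamily.continuous_ofReal (hG : IsKernelFamily G) (i : ι) :
    Continuous fun z => ENNReal.ofReal (G i z) :=
  ENNReal.continuous_ofReal.comp (hG.continuous i)

theorem lowerSemicontinuous_synth (hG : IsKernelFamily G) {f : ι → ℝ≥0∞} :
    LowerSemicontinuous (synth G f) := by
  refine lowerSemicontinuous_tsum fun i => ?_
  -- Multiplication by `⊤` is not continuous, but the term is then `⊤` times the indicator of an
  -- open set.
  by_cases hf : f i = ⊤
  · have : (fun z => f i * ENNReal.ofReal (G i z)) =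
        {z | 0 < ENNReal.ofReal (G i z)}.indicator (fun _ => (⊤ : ℝ≥0∞)) := by
      funext z
      by_cases hz : 0 < ENNReal.ofReal (G i z)
      · rw [indicator_of_mem (by exact hz), hf, ENNReal.top_mul hz.ne']
      · rw [indicator_of_notMem (by exact hz), nonpos_iff_eq_zero.1 (not_lt.1 hz), mul_zero]
    rw [this]
    exact (isOpen_lt continuous_const (hG.continuous_ofReal i)).lowerSemicontinuous_indicator bot_le
  · exact (ENNReal.continuous_const_mul hf |>.comp (hG.continuous_ofReal i)).lowerSemicontinuous

theorem isOpen_lt_synth (hG : IsKernelFamily G) (f : ι → ℝ≥0∞) (a : ℝ≥0∞) :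
    IsOpen {z | a < synth G f z} :=
  (lowerSemicontinuous_synth hG).isOpen_preimage a

theorem isClosed_synth_le (hG : IsKernelFamily G) (f : ι → ℝ≥0∞) (a : ℝ≥0∞) :
    IsClosed {z | synth G f z ≤ a} := by
  have := (isOpen_lt_synth hG f a).isClosed_compl
  convert this using 1
  ext z; simp

theorem measurable_synth (hG : IsKernelFamily G) (f : ι → ℝ≥0∞) : Measurable (synth G f) :=
  (lowerSemicontinuous_synth hG).measurable

theorem synth_mono {f g : ι → ℝ≥0∞} (h : f ≤ g) (z : X) : synth G f z ≤ synth G g z :=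
  ENNReal.tsum_le_tsum fun i => mul_le_mul_left (h i) _

theorem synth_add (f g : ι → ℝ≥0∞) (z : X) :
    synth G (fun i => f i + g i) z = synth G f z + synth G g z := by
  simp only [synth, add_mul, ENNReal.tsum_add]

theorem synth_const_mul (c : ℝ≥0∞) (f : ι → ℝ≥0∞) (z : X) :
    synth G (fun i => c * f i) z = c * synth G f z := by
  simp only [synth, mul_assoc, ENNReal.tsum_mul_left]

theorem lintegral_synth (hG : IsKernelFamily G) (f : ι → ℝ≥0∞) (ν : Measure X) :
    ∫⁻ z, synth G f z ∂ν = ∑' i, f i * coeff G ν i := by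
  unfold synth coeff
  rw [lintegral_tsum fun i =>
    ((hG.continuous_ofReal i).measurable.const_mul _).aemeasurable]
  exact tsum_congr fun i => lintegral_const_mul _ (hG.continuous_ofReal i).measurable

theorem coeff_ne_top (hG : IsKernelFamily G) (μ : Measure X) [IsLocallyFiniteMeasure μ] (i : ι) :
    coeff G μ i ≠ ⊤ := by
  have h := (hG.continuous i).integrable_of_hasCompactSupport (μ := μ) (hG.hasCompactSupport i)
  rw [coeff, ← ofReal_integral_eq_lintegral_ofReal h (Eventually.of_forall (hG.nonneg i))]
  exact ENNReal.ofReal_ne_top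

theorem rpow_sub_one_mul_self (hr : 1 < r) (x : ℝ≥0∞) : x ^ (r - 1) * x = x ^ r := by
  conv_lhs => rw [← ENNReal.rpow_one x, ← ENNReal.rpow_mul, one_mul]
  rw [← ENNReal.rpow_add_of_nonneg _ _ (by linarith) zero_le_one]
  ring_nf

theorem energy_eq_tsum (hG : IsKernelFamily G) (hr : 1 < r) (μ : Measure X) :
    energy G r μ = ∑' i, coeff G μ i ^ r := by
  rw [energy, pot, lintegral_synth hG]
  exact tsum_congr fun i => rpow_sub_one_mul_self hr _

theorem coeff_smul (c : ℝ≥0∞) (μ : Measure X) (i : ι) :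
    coeff G (c • μ) i = c * coeff G μ i := by
  simp [coeff, lintegral_smul_measure]

theorem coeff_add (μ ν : Measure X) (i : ι) :
    coeff G (μ + ν) i = coeff G μ i + coeff G ν i := by
  simp [coeff, lintegral_add_measure]

theorem coeff_mono {μ ν : Measure X} (h : μ ≤ ν) (i : ι) : coeff G μ i ≤ coeff G ν i :=
  lintegral_mono' h le_rfl

theorem energy_mono (hG : IsKernelFamily G) (hr : 1 < r) {μ ν : Measure X} (h : μ ≤ ν) :
    energy G r μ ≤ energy G r ν := by
  rw [energy_eq_tsum hG hr, energy_eq_tsum hG hr]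
  exact ENNReal.tsum_le_tsum fun i => ENNReal.rpow_le_rpow (coeff_mono h i) (by linarith)

theorem energy_smul (hG : IsKernelFamily G) (hr : 1 < r) (c : ℝ≥0∞) (μ : Measure X) :
    energy G r (c • μ) = c ^ r * energy G r μ := by
  rw [energy_eq_tsum hG hr, energy_eq_tsum hG hr, ← ENNReal.tsum_mul_left]
  exact tsum_congr fun i => by rw [coeff_smul, ENNReal.mul_rpow_of_nonneg _ _ (by linarith)]

theorem pot_smul (hr : 1 < r) (c : ℝ≥0∞) (μ : Measure X) (z : X) :
    pot G r (c • μ) z = c ^ (r - 1) * pot G r μ z := by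
  rw [pot, pot, ← synth_const_mul]
  congr 1
  funext i
  rw [coeff_smul, ENNReal.mul_rpow_of_nonneg _ _ (by linarith)]

theorem tsum_mul_le (hqr : q.HolderConjugate r) (f y : ι → ℝ≥0∞) :
    ∑' i, f i * y i ≤ (∑' i, f i ^ q) ^ (1 / q) * (∑' i, y i ^ r) ^ (1 / r) := by
  let _ : MeasurableSpace ι := ⊤
  have hm : ∀ g : ι → ℝ≥0∞, AEMeasurable g Measure.count :=
    fun g => (measurable_of_countable g).aemeasurable
  simpa [lintegral_count, Pi.mul_apply] using
    ENNReal.lintegral_mul_le_Lp_mul_Lq (Measure.count : Measure ι) hqr (hm f) (hm y)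

theorem lintegral_synth_le (hG : IsKernelFamily G) (hqr : q.HolderConjugate r) (f : ι → ℝ≥0∞)
    (ν : Measure X) :
    ∫⁻ z, synth G f z ∂ν ≤ (∑' i, f i ^ q) ^ (1 / q) * energy G r ν ^ (1 / r) := by
  rw [lintegral_synth hG, energy_eq_tsum hG hqr.symm.lt]
  exact tsum_mul_le hqr _ _

end Potential

/-! ### Energy and potential under vague limits -/

section Vague

variable {μ : ℕ → Measure X} {U : Ultrafilter ℕ} {γ : Measure X}

theorem VagueTendsto.coeff (hG : IsKernelFamily G) (h : VagueTendsto μ U γ) (i : ι) :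
    Tendsto (fun n => coeff G (μ n) i) U (𝓝 (coeff G γ i)) :=
  h _ (hG.continuous i) (hG.hasCompactSupport i) (hG.nonneg i)

theorem tsum_le_of_tendsto {l : Filter ℕ} [l.NeBot] {f : ℕ → ι → ℝ≥0∞} {g : ι → ℝ≥0∞}
    (hfg : ∀ i, Tendsto (fun n => f n i) l (𝓝 (g i))) {a : ℝ≥0∞} {b : ℕ → ℝ≥0∞}
    (hb : Tendsto b l (𝓝 a)) (h : ∀ᶠ n in l, ∑' i, f n i ≤ b n) : ∑' i, g i ≤ a := by
  rw [ENNReal.tsum_eq_iSup_sum]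
  refine iSup_le fun s => ?_
  exact le_of_tendsto_of_tendsto (tendsto_finsetSum s fun i _ => hfg i) hb
    (h.mono fun n hn => (ENNReal.sum_le_tsum s).trans hn)

theorem VagueTendsto.energy_le (hG : IsKernelFamily G) (hr : 1 < r) (h : VagueTendsto μ U γ)
    {a : ℝ≥0∞} {b : ℕ → ℝ≥0∞} (hb : Tendsto b U (𝓝 a))
    (hμ : ∀ᶠ n in (U : Filter ℕ), energy G r (μ n) ≤ b n) : energy G r γ ≤ a := by
  rw [energy_eq_tsum hG hr]
  refine tsum_le_of_tendsto (l := U) (f := fun n i => WolffCapacity.coeff G (μ n) i ^ r)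
    (fun i => (ENNReal.continuous_rpow_const.tendsto _).comp (h.coeff hG i)) hb ?_
  simpa only [energy_eq_tsum hG hr] using hμ

/-- Finite partial sums are jointly continuous in the coefficients and the point, and each
neighbourhood of a point of `γ.support` is charged by `μ n` along `U`, hence meets `(μ n).support`.
-/
theorem VagueTendsto.pot_le (hG : IsKernelFamily G) (hr : 1 < r) [γ.Regular]
    (h : VagueTendsto μ U γ) {a : ℝ≥0∞}
    (hμ : ∀ n, ∀ z ∈ (μ n).support, pot G r (μ n) z ≤ a) :
    ∀ z ∈ γ.support, pot G r γ z ≤ a := by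
  intro z hz
  rw [pot, synth, ENNReal.tsum_eq_iSup_sum]
  refine iSup_le fun s => ?_
  by_contra! hlt
  have hT : Tendsto (fun p : ℕ × X => ∑ i ∈ s,
      WolffCapacity.coeff G (μ p.1) i ^ (r - 1) * ENNReal.ofReal (G i p.2)) (U ×ˢ 𝓝 z)
      (𝓝 (∑ i ∈ s, WolffCapacity.coeff G γ i ^ (r - 1) * ENNReal.ofReal (G i z))) := by
    refine tendsto_finsetSum s fun i _ => ?_
    refine ENNReal.Tendsto.mul
      (((ENNReal.continuous_rpow_const.tendsto _).comp (h.coeff hG i)).comp tendsto_fst)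
      (Or.inr ENNReal.ofReal_ne_top) (((hG.continuous_ofReal i).tendsto z).comp tendsto_snd)
      (Or.inr (ENNReal.rpow_ne_top_of_nonneg (by linarith) (coeff_ne_top hG γ i)))
  obtain ⟨A, hA, B, hB, hAB⟩ := eventually_prod_iff.1 (hT.eventually_const_lt hlt)
  obtain ⟨V, hVB, hV, hzV⟩ := mem_nhds_iff.1 hB
  have hpos := h.eventually_measure_pos hV
    ((Measure.mem_support_iff_forall z).1 hz V (hV.mem_nhds hzV))
  obtain ⟨n, hn, hnA⟩ := (hpos.and hA).exists
  obtain ⟨w, hwV, hw⟩ := exists_mem_support hn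
  have h1 := hAB hnA (hVB hwV)
  exact absurd (h1.trans_le ((ENNReal.sum_le_tsum s).trans (hμ n w hw))) (lt_irrefl _)

end Vague

/-! ### Capacity: subadditivity and the Chebyshev inequality -/

section Capacity

theorem isFiniteMeasure_of_compl_null {K : Set X} (hK : IsCompact K) (μ : Measure X)
    [IsLocallyFiniteMeasure μ] (h : μ Kᶜ = 0) : IsFiniteMeasure μ := by
  refine ⟨?_⟩
  rw [← union_compl_self K]
  exact (measure_union_le _ _).trans_lt (by simpa [h] using hK.measure_lt_top)

theorem measure_univ_le_maxMass {K : Set X} (μ : Measure X) [h : IsLocallyFiniteMeasure μ]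
    (hK : μ Kᶜ = 0) (hE : energy G r μ ≤ 1) : μ univ ≤ maxMass G r K :=
  le_iSup₂_of_le μ h (le_iSup₂_of_le hK hE le_rfl)

theorem maxMass_le {K : Set X} {a : ℝ≥0∞}
    (h : ∀ μ : Measure X, IsLocallyFiniteMeasure μ → μ Kᶜ = 0 → energy G r μ ≤ 1 → μ univ ≤ a) :
    maxMass G r K ≤ a :=
  iSup₂_le fun μ h1 => iSup₂_le fun h2 h3 => h μ h1 h2 h3

theorem exists_of_lt_maxMass {K : Set X} {a : ℝ≥0∞} (h : a < maxMass G r K) :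
    ∃ μ : Measure X, IsLocallyFiniteMeasure μ ∧ μ Kᶜ = 0 ∧ energy G r μ ≤ 1 ∧ a < μ univ := by
  by_contra! hcon
  exact absurd h (not_lt.2 (maxMass_le hcon))

theorem maxMass_mono {K L : Set X} (h : K ⊆ L) : maxMass G r K ≤ maxMass G r L :=
  maxMass_le fun μ _ h2 h3 =>
    measure_univ_le_maxMass μ (measure_mono_null (compl_subset_compl.2 h) h2) h3

theorem maxMass_le_innerMass {K V : Set X} (hK : IsCompact K) (h : K ⊆ V) :
    maxMass G r K ≤ innerMass G r V :=
  le_iSup₂_of_le K hK (le_iSup_of_le h le_rfl)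

theorem innerMass_le {V : Set X} {a : ℝ≥0∞}
    (h : ∀ K, IsCompact K → K ⊆ V → maxMass G r K ≤ a) : innerMass G r V ≤ a :=
  iSup₂_le fun K hK => iSup_le fun hKV => h K hK hKV

theorem innerMass_mono {V W : Set X} (h : V ⊆ W) : innerMass G r V ≤ innerMass G r W :=
  innerMass_le fun _ hK hKV => maxMass_le_innerMass hK (hKV.trans h)

theorem rootCap_le_innerMass {E V : Set X} (hV : IsOpen V) (h : E ⊆ V) :
    rootCap G r E ≤ innerMass G r V :=
  iInf₂_le_of_le V hV (iInf_le_of_le h le_rfl)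

theorem le_rootCap {E : Set X} {a : ℝ≥0∞}
    (h : ∀ V, IsOpen V → E ⊆ V → a ≤ innerMass G r V) : a ≤ rootCap G r E :=
  le_iInf₂ fun V hV => le_iInf fun hEV => h V hV hEV

theorem rootCap_mono {E F : Set X} (h : E ⊆ F) : rootCap G r E ≤ rootCap G r F :=
  le_rootCap fun _ hV hFV => rootCap_le_innerMass hV (h.trans hFV)

theorem rootCap_null_mono {E F : Set X} (h : E ⊆ F) (hF : rootCap G r F = 0) :
    rootCap G r E = 0 :=
  le_antisymm (hF ▸ rootCap_mono h) bot_le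

theorem rootCap_of_isOpen {V : Set X} (hV : IsOpen V) : rootCap G r V = innerMass G r V :=
  le_antisymm (rootCap_le_innerMass hV subset_rfl) (le_rootCap fun _ _ h => innerMass_mono h)

theorem maxMass_le_rootCap {K : Set X} (hK : IsCompact K) : maxMass G r K ≤ rootCap G r K :=
  le_rootCap fun _ _ h => maxMass_le_innerMass hK h

theorem exists_isOpen_of_rootCap_lt {E : Set X} {a : ℝ≥0∞} (h : rootCap G r E < a) :
    ∃ V, IsOpen V ∧ E ⊆ V ∧ innerMass G r V < a := by
  by_contra! hcon
  exact absurd h (not_lt.2 (le_rootCap hcon))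

/-- Restricting to a compact subset does not increase the energy. This domination of admissible
measures yields countable subadditivity. -/
theorem measure_le_innerMass (hG : IsKernelFamily G) (hr : 1 < r) {V : Set X} (hV : IsOpen V)
    (μ : Measure X) [IsFiniteMeasure μ] (hE : energy G r μ ≤ 1) : μ V ≤ innerMass G r V := by
  rw [hV.measure_eq_iSup_isCompact]
  refine iSup₂_le fun K hKV => iSup_le fun hK => ?_
  refine le_trans ?_ (maxMass_le_innerMass hK hKV)
  have := measure_univ_le_maxMass (G := G) (r := r) (K := K) (μ.restrict K)
    (by rw [Measure.restrict_apply hK.measurableSet.compl]; simp)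
    ((energy_mono hG hr Measure.restrict_le_self).trans hE)
  simpa using this

theorem innerMass_iUnion_le (hG : IsKernelFamily G) (hr : 1 < r) {κ : Type*} [Countable κ]
    {V : κ → Set X} (hV : ∀ k, IsOpen (V k)) :
    innerMass G r (⋃ k, V k) ≤ ∑' k, innerMass G r (V k) := by
  refine innerMass_le fun K hK hKV => maxMass_le fun μ _ h2 h3 => ?_
  have := isFiniteMeasure_of_compl_null hK μ h2
  calc μ univ ≤ μ (⋃ k, V k) + μ Kᶜ := by
        refine (measure_mono ?_).trans (measure_union_le _ _)
        rw [← union_compl_self K]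
        exact union_subset_union_left _ hKV
    _ = μ (⋃ k, V k) := by rw [h2, add_zero]
    _ ≤ ∑' k, μ (V k) := measure_iUnion_le _
    _ ≤ _ := ENNReal.tsum_le_tsum fun k => measure_le_innerMass hG hr (hV k) μ h3

theorem rootCap_iUnion_le (hG : IsKernelFamily G) (hr : 1 < r) {κ : Type*} [Countable κ]
    (E : κ → Set X) : rootCap G r (⋃ k, E k) ≤ ∑' k, rootCap G r (E k) := by
  refine ENNReal.le_of_forall_pos_le_add fun ε hε hfin => ?_
  obtain ⟨δ, hδ, hsum⟩ := ENNReal.exists_pos_sum_of_countable'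
    (ENNReal.coe_pos.2 hε).ne' κ
  have hex : ∀ k, ∃ V, IsOpen V ∧ E k ⊆ V ∧ innerMass G r V < rootCap G r (E k) + δ k := fun k =>
    exists_isOpen_of_rootCap_lt (ENNReal.lt_add_right
      ((ENNReal.le_tsum k).trans_lt hfin).ne (hδ k).ne')
  choose V hV hEV hlt using hex
  calc rootCap G r (⋃ k, E k) ≤ innerMass G r (⋃ k, V k) :=
        rootCap_le_innerMass (isOpen_iUnion hV) (iUnion_mono hEV)
    _ ≤ ∑' k, innerMass G r (V k) := innerMass_iUnion_le hG hr hV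
    _ ≤ ∑' k, (rootCap G r (E k) + δ k) := ENNReal.tsum_le_tsum fun k => (hlt k).le
    _ = ∑' k, rootCap G r (E k) + ∑' k, δ k := ENNReal.tsum_add
    _ ≤ _ := by gcongr

theorem rootCap_iUnion_null (hG : IsKernelFamily G) (hr : 1 < r) {κ : Type*} [Countable κ]
    {E : κ → Set X} (h : ∀ k, rootCap G r (E k) = 0) : rootCap G r (⋃ k, E k) = 0 :=
  le_antisymm ((rootCap_iUnion_le hG hr E).trans (by simp [h])) bot_le

theorem rootCap_union_le (hG : IsKernelFamily G) (hr : 1 < r) (E F : Set X) :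
    rootCap G r (E ∪ F) ≤ rootCap G r E + rootCap G r F := by
  rw [union_eq_iUnion]
  refine (rootCap_iUnion_le hG hr _).trans ?_
  rw [tsum_bool, add_comm]
  rfl

/-- Capacitary Chebyshev inequality. The superlevel set is open by lower semicontinuity, so measures
on its compact subsets suffice, and Hölder bounds their integral of the potential. -/
theorem mul_rootCap_lt_synth_le (hG : IsKernelFamily G) (hqr : q.HolderConjugate r)
    (f : ι → ℝ≥0∞) (a : ℝ≥0∞) :
    a * rootCap G r {z | a < synth G f z} ≤ (∑' i, f i ^ q) ^ (1 / q) := by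
  rw [rootCap_of_isOpen (isOpen_lt_synth hG f a)]
  simp only [innerMass, maxMass, ENNReal.mul_iSup]
  refine iSup₂_le fun K _ => iSup_le fun hKV => iSup₂_le fun μ _ => iSup₂_le fun h2 h3 => ?_
  calc a * μ univ = ∫⁻ _, a ∂μ := by rw [lintegral_const]
    _ ≤ ∫⁻ z, synth G f z ∂μ := by
      refine lintegral_mono_ae ?_
      filter_upwards [show ∀ᵐ x ∂μ, x ∈ K from h2] with x hx using (hKV hx).le
    _ ≤ (∑' i, f i ^ q) ^ (1 / q) * energy G r μ ^ (1 / r) := lintegral_synth_le hG hqr f μ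
    _ ≤ (∑' i, f i ^ q) ^ (1 / q) * 1 := by
      gcongr
      exact ENNReal.rpow_le_one h3 (one_div_nonneg.2 hqr.symm.nonneg)
    _ = _ := mul_one _

/-- If `∑ f i * G i` is at least `1` quasi-everywhere on `E`, then `f` is an admissible
competitor for the capacity of `E`. -/
theorem rootCap_le_of_one_le_synth (hG : IsKernelFamily G) (hqr : q.HolderConjugate r)
    {f : ι → ℝ≥0∞} {E : Set X} (h : rootCap G r {z ∈ E | ¬ 1 ≤ synth G f z} = 0) :
    rootCap G r E ≤ (∑' i, f i ^ q) ^ (1 / q) := by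
  -- The set where the potential is at least `1` need not be open; strict levels `a < 1` are, and
  -- `a` then tends to `1`.
  have hlt : ∀ a < (1 : ℝ≥0∞), a * rootCap G r E ≤ (∑' i, f i ^ q) ^ (1 / q) := by
    intro a ha
    refine le_trans ?_ (mul_rootCap_lt_synth_le hG hqr f a)
    gcongr
    have hsub : E ⊆ {z ∈ E | ¬ 1 ≤ synth G f z} ∪ {z | a < synth G f z} := by
      intro z hz
      by_cases h1 : 1 ≤ synth G f z
      · exact Or.inr (ha.trans_le h1)
      · exact Or.inl ⟨hz, h1⟩
    exact (rootCap_mono hsub).trans ((rootCap_union_le hG hqr.symm.lt _ _).trans (by rw [h, zero_add]))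
  by_contra! hcon
  obtain ⟨b, hb1, hb2⟩ := exists_between hcon
  have hb0 : b ≠ 0 := (bot_le.trans_lt hb1).ne'
  have hbt : b ≠ ⊤ := hb2.ne_top
  obtain ⟨c, hc1, hc2⟩ := exists_between hb2
  have := hlt (b / c) ((ENNReal.div_lt_iff (Or.inl (bot_le.trans_lt hc1).ne')
    (Or.inl hc2.ne_top)).2 (by rwa [one_mul]))
  have h2 : b ≤ b / c * rootCap G r E := by
    calc b = b / c * c := (ENNReal.div_mul_cancel (bot_le.trans_lt hc1).ne' hc2.ne_top).symm
      _ ≤ _ := by gcongr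
  exact absurd (hb1.trans_le (h2.trans this)) (lt_irrefl _)

/-- Where the potential of `f` is below `1 - 1/k` and that of `F n` is at least `1`, the potential
of the truncated difference `F n - f` exceeds `1/k`; Chebyshev makes this set small. Only the
positive part of the difference matters. -/
theorem rootCap_one_le_synth_of_approx (hG : IsKernelFamily G) (hqr : q.HolderConjugate r)
    {f : ι → ℝ≥0∞} {F : ℕ → ι → ℝ≥0∞} {E : Set X}
    (hF : ∀ᶠ n in atTop, rootCap G r {z ∈ E | ¬ 1 ≤ synth G (F n) z} = 0)
    (hlim : Tendsto (fun n => ∑' i, (F n i - f i) ^ q) atTop (𝓝 0)) :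
    rootCap G r {z ∈ E | ¬ 1 ≤ synth G f z} = 0 := by
  have hsub : {z ∈ E | ¬ 1 ≤ synth G f z} ⊆
      ⋃ k : ℕ, {z ∈ E | synth G f z + ((k : ℝ≥0∞))⁻¹ < 1} := by
    rintro z ⟨hz, h1⟩
    rw [not_le] at h1
    obtain ⟨k, hk⟩ := ENNReal.exists_inv_nat_lt (tsub_pos_of_lt h1).ne'
    exact mem_iUnion.2 ⟨k, hz, by rw [add_comm]; exact lt_tsub_iff_right.1 hk⟩
  refine rootCap_null_mono hsub (rootCap_iUnion_null hG hqr.symm.lt fun k => ?_)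
  have hlim' : Tendsto (fun n => (∑' i, (F n i - f i) ^ q) ^ (1 / q)) atTop (𝓝 0) := by
    have := ((ENNReal.continuous_rpow_const (y := 1 / q)).tendsto 0).comp hlim
    rwa [ENNReal.zero_rpow_of_pos (one_div_pos.2 hqr.pos)] at this
  have hbound : ∀ᶠ n in atTop, ((k : ℝ≥0∞))⁻¹ *
      rootCap G r {z ∈ E | synth G f z + ((k : ℝ≥0∞))⁻¹ < 1} ≤
        (∑' i, (F n i - f i) ^ q) ^ (1 / q) := by
    filter_upwards [hF] with n hn
    refine le_trans ?_ (mul_rootCap_lt_synth_le hG hqr (fun i => F n i - f i) (k : ℝ≥0∞)⁻¹)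
    gcongr
    have hsub : {z ∈ E | synth G f z + ((k : ℝ≥0∞))⁻¹ < 1} ⊆
        {z ∈ E | ¬ 1 ≤ synth G (F n) z} ∪
          {z | ((k : ℝ≥0∞))⁻¹ < synth G (fun i => F n i - f i) z} := by
      rintro z ⟨hz, h1⟩
      by_cases h2 : 1 ≤ synth G (F n) z
      · right
        have h3 : synth G (F n) z ≤ synth G f z + synth G (fun i => F n i - f i) z := by
          rw [← synth_add]
          exact synth_mono (fun i => le_add_tsub) z
        exact lt_of_add_lt_add_left (h1.trans_le (h2.trans h3))
      · exact Or.inl ⟨hz, h2⟩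
    exact (rootCap_mono hsub).trans ((rootCap_union_le hG hqr.symm.lt _ _).trans
      (by rw [hn, zero_add]))
  have := le_antisymm (ge_of_tendsto hlim' hbound) bot_le
  exact (mul_eq_zero.1 this).resolve_left (ENNReal.inv_ne_zero.2 (ENNReal.natCast_ne_top k))

end Capacity

/-! ### Extremal measures and outer regularity on compact sets -/

section Compactness

theorem iInter_cthickening_one_div (E : Set X) :
    ⋂ n : ℕ, Metric.cthickening (1 / ((n : ℝ) + 1)) E = closure E := by
  refine subset_antisymm (fun x hx => ?_)
    (subset_iInter fun n => Metric.closure_subset_cthickening _ _)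
  rw [Metric.mem_closure_iff_infEDist_zero]
  refine le_antisymm ?_ bot_le
  have h := ENNReal.tendsto_ofReal (tendsto_one_div_add_atTop_nhds_zero_nat (𝕜 := ℝ))
  rw [ENNReal.ofReal_zero] at h
  exact ge_of_tendsto' h fun n => Metric.mem_cthickening_iff.1 (mem_iInter.1 hx n)

theorem exists_limit_measure (hG : IsKernelFamily G) (hr : 1 < r) {L : ℕ → Set X}
    (hL : Antitone L) (hLc : ∀ n, IsCompact (L n)) {μ : ℕ → Measure X}
    (hμL : ∀ n, μ n (L n)ᶜ = 0) (hμE : ∀ n, energy G r (μ n) ≤ 1) {M : ℝ≥0∞} (hM : M ≠ ⊤)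
    (hb : ∀ n, μ n univ ≤ M) (hlim : Tendsto (fun n => μ n univ) atTop (𝓝 M)) :
    ∃ γ : Measure X, γ.Regular ∧ γ (⋂ n, L n)ᶜ = 0 ∧ γ univ = M ∧ energy G r γ ≤ 1 := by
  obtain ⟨γ, hγ, h⟩ := exists_vagueTendsto μ (Ultrafilter.of atTop) M hM hb
  refine ⟨γ, hγ, ?_, ?_, ?_⟩
  · rw [compl_iInter]
    refine measure_iUnion_null fun k => le_antisymm
      (h.measure_le (hLc k).isClosed.isOpen_compl ?_) bot_le
    refine ((eventually_ge_atTop k).filter_mono (Ultrafilter.of_le _)).mono fun n hn => ?_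
    exact (measure_mono (compl_subset_compl.2 (hL hn))).trans (hμL n).le
  · exact h.measure_univ (hLc 0)
      (fun n => measure_mono_null (compl_subset_compl.2 (hL n.zero_le)) (hμL n))
      (hlim.mono_left (Ultrafilter.of_le _))
  · exact h.energy_le hG hr tendsto_const_nhds (Eventually.of_forall hμE)

theorem rootCap_of_isCompact (hG : IsKernelFamily G) (hr : 1 < r) {K : Set X} (hK : IsCompact K) :
    rootCap G r K = maxMass G r K := by
  refine le_antisymm (le_of_forall_lt fun M hM => ?_) (maxMass_le_rootCap hK)
  obtain ⟨M', hMM', hM'⟩ := exists_between hM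
  refine hMM'.trans_le ?_
  have hMt : M' ≠ ⊤ := hM'.ne_top
  have hex : ∀ n : ℕ, ∃ μ : Measure X, μ (Metric.cthickening (1 / ((n : ℝ) + 1)) K)ᶜ = 0 ∧
      energy G r μ ≤ 1 ∧ μ univ = M' := by
    intro n
    have h1 := hM'.trans_le (rootCap_le_innerMass (Metric.isOpen_thickening (E := K))
      (Metric.self_subset_thickening (δ := 1 / ((n : ℝ) + 1)) (by positivity) K))
    obtain ⟨L, hL⟩ := lt_iSup_iff.1 h1
    obtain ⟨hLc, hL⟩ := lt_iSup_iff.1 hL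
    obtain ⟨hLV, hL⟩ := lt_iSup_iff.1 hL
    obtain ⟨μ, hμ1, hμ2, hμ3, hμ4⟩ := exists_of_lt_maxMass hL
    have := isFiniteMeasure_of_compl_null hLc μ hμ2
    have h0 : μ univ ≠ 0 := (bot_le.trans_lt hμ4).ne'
    -- Scaling down to mass exactly `M'` keeps the energy at most `1` and makes the masses constant
    -- and finite, even if the capacity is infinite.
    refine ⟨(M' / μ univ) • μ, ?_, ?_, ?_⟩
    · rw [Measure.smul_apply, measure_mono_null (compl_subset_compl.2
        (hLV.trans (Metric.thickening_subset_cthickening _ _))) hμ2, smul_zero]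
    · rw [energy_smul hG hr]
      refine mul_le_one' (ENNReal.rpow_le_one ?_ (by linarith)) hμ3
      exact ENNReal.div_le_of_le_mul (by rw [one_mul]; exact hμ4.le)
    · rw [Measure.smul_apply, smul_eq_mul, ENNReal.div_mul_cancel h0 (measure_ne_top μ _)]
  choose μ h1 h2 h3 using hex
  obtain ⟨γ, hγ, hγ1, hγ2, hγ3⟩ := exists_limit_measure hG hr
    (L := fun n : ℕ => Metric.cthickening (1 / ((n : ℝ) + 1)) K)
    (fun m n hmn => Metric.cthickening_mono (Nat.one_div_le_one_div hmn) K)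
    (fun n => hK.cthickening) h1 h2 hMt (fun n => (h3 n).le)
    (by simp only [h3]; exact tendsto_const_nhds)
  rw [iInter_cthickening_one_div, hK.isClosed.closure_eq] at hγ1
  rw [← hγ2]
  exact measure_univ_le_maxMass γ hγ1 hγ3

theorem exists_maximiser (hG : IsKernelFamily G) (hr : 1 < r) {K : Set X} (hK : IsCompact K)
    (h0 : maxMass G r K ≠ 0) (ht : maxMass G r K ≠ ⊤) :
    ∃ γ : Measure X, γ.Regular ∧ γ Kᶜ = 0 ∧ γ univ = maxMass G r K ∧ energy G r γ ≤ 1 := by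
  obtain ⟨u, -, hu, hlim⟩ := exists_seq_strictMono_tendsto' (pos_iff_ne_zero.2 h0)
  have hex := fun n => exists_of_lt_maxMass (hu n).2
  choose μ h1 h2 h3 h4 using hex
  have hle : ∀ n, μ n univ ≤ maxMass G r K := fun n =>
    have := h1 n
    measure_univ_le_maxMass (μ n) (h2 n) (h3 n)
  obtain ⟨γ, hγ, hγ1, hγ2, hγ3⟩ := exists_limit_measure hG hr (L := fun _ => K)
    (fun _ _ _ => le_rfl) (fun _ => hK) h2 h3 ht hle
    (tendsto_of_tendsto_of_tendsto_of_le_of_le hlim tendsto_const_nhds (fun n => (h4 n).le) hle)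
  exact ⟨γ, hγ, by simpa using hγ1, hγ2, hγ3⟩

end Compactness

/-! ### First variation and the compact case -/

theorem one_add_mul_le_rpow_one_add (hr : 1 < r) (u : ℝ≥0∞) :
    1 + ENNReal.ofReal r * u ≤ (1 + u) ^ r := by
  by_cases hu : u = ⊤
  · simp [hu, ENNReal.top_rpow_of_pos (show 0 < r by linarith)]
  lift u to NNReal using hu
  have h := one_add_mul_self_le_rpow_one_add (s := (u : ℝ)) (by linarith [u.coe_nonneg]) hr.le
  have h2 : ENNReal.ofReal (1 + r * u) ≤ ENNReal.ofReal ((1 + u) ^ r) :=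
    ENNReal.ofReal_le_ofReal h
  rwa [← ENNReal.ofReal_rpow_of_nonneg (by positivity) (by linarith), ENNReal.ofReal_add zero_le_one
    (by positivity), ENNReal.ofReal_mul (by linarith), ENNReal.ofReal_add zero_le_one
    (by positivity), ENNReal.ofReal_one, ENNReal.ofReal_coe_nnreal] at h2

/-- The tangent line to the convex function $x^r$ at $a+b$, evaluated at $a$; written without
subtraction. -/
theorem add_rpow_le (hr : 1 < r) (a b : ℝ≥0∞) :
    (a + b) ^ r ≤ a ^ r + ENNReal.ofReal r * (b * (a + b) ^ (r - 1)) := by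
  have hr0 : 0 < r := by linarith
  have hrt : ENNReal.ofReal r ≠ 0 := by simpa using hr0
  by_cases ha : a = ⊤
  · simp [ha, ENNReal.top_rpow_of_pos hr0]
  by_cases hb : b = ⊤
  · simp [hb, ENNReal.top_rpow_of_pos (show 0 < r - 1 by linarith), ENNReal.mul_top hrt]
  lift a to NNReal using ha
  lift b to NNReal using hb
  have key : ((a : ℝ) + b) ^ r ≤ (a : ℝ) ^ r + r * (b * ((a : ℝ) + b) ^ (r - 1)) := by
    rcases eq_or_lt_of_le (add_nonneg a.coe_nonneg b.coe_nonneg) with h0 | hx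
    · rw [← h0, Real.zero_rpow hr0.ne', Real.zero_rpow (by linarith)]
      have := a.coe_nonneg
      positivity
    · have h := one_add_mul_self_le_rpow_one_add (s := (a : ℝ) / (a + b) - 1)
        (by have : (0 : ℝ) ≤ (a : ℝ) / (a + b) := by positivity
            linarith) hr.le
      rw [add_sub_cancel, Real.div_rpow a.coe_nonneg hx.le, le_div_iff₀ (by positivity)] at h
      have e : ((a : ℝ) + b) ^ r = (a + b) ^ (r - 1) * (a + b) := by
        rw [← Real.rpow_add_one hx.ne']; ring_nf
      have e2 : (1 + r * ((a : ℝ) / (a + b) - 1)) * (a + b) ^ r =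
          (a + b) ^ r - r * (b * ((a : ℝ) + b) ^ (r - 1)) := by
        rw [e]; field_simp; ring
      linarith
  have h2 := ENNReal.ofReal_le_ofReal key
  have hab : (0 : ℝ) ≤ (a : ℝ) + b := by positivity
  rwa [← ENNReal.ofReal_rpow_of_nonneg hab hr0.le,
    ENNReal.ofReal_add (Real.rpow_nonneg a.coe_nonneg r) (by positivity),
    ← ENNReal.ofReal_rpow_of_nonneg a.coe_nonneg hr0.le, ENNReal.ofReal_mul hr0.le,
    ENNReal.ofReal_mul b.coe_nonneg, ← ENNReal.ofReal_rpow_of_nonneg hab (by linarith),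
    ENNReal.ofReal_add a.coe_nonneg b.coe_nonneg, ENNReal.ofReal_coe_nnreal,
    ENNReal.ofReal_coe_nnreal] at h2

theorem tendsto_tsum_of_dominated {f : ℕ → ι → ℝ≥0∞} {g b : ι → ℝ≥0∞} (hb : ∑' i, b i ≠ ⊤)
    (hle : ∀ n i, f n i ≤ b i) (hlim : ∀ i, Tendsto (fun n => f n i) atTop (𝓝 (g i))) :
    Tendsto (fun n => ∑' i, f n i) atTop (𝓝 (∑' i, g i)) := by
  let _ : MeasurableSpace ι := ⊤
  have := tendsto_lintegral_of_dominated_convergence (μ := (Measure.count : Measure ι))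
    (F := f) (f := g) b (fun n => measurable_of_countable _)
    (fun n => Eventually.of_forall (hle n)) (by simpa [lintegral_count] using hb)
    (Eventually.of_forall hlim)
  simpa [lintegral_count] using this

/-- Homogeneous form of the definition of `maxMass`. If the energy vanishes, all multiples of `ν`
are admissible, so finiteness of `maxMass` forces `ν` to vanish. -/
theorem measure_univ_rpow_le (hG : IsKernelFamily G) (hr : 1 < r) {K : Set X} (hK : IsCompact K)
    (ht : maxMass G r K ≠ ⊤) (ν : Measure X) [IsLocallyFiniteMeasure ν] (hν : ν Kᶜ = 0)
    (hE : energy G r ν ≠ ⊤) : ν univ ^ r ≤ maxMass G r K ^ r * energy G r ν := by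
  have hr0 : 0 < r := by linarith
  have := isFiniteMeasure_of_compl_null hK ν hν
  have key : ∀ c : ℝ≥0∞, c ≠ ⊤ → c ^ r * energy G r ν ≤ 1 → c * ν univ ≤ maxMass G r K := by
    intro c hc hcE
    have := Measure.smul_finite ν hc
    have h := measure_univ_le_maxMass (G := G) (r := r) (K := K) (c • ν)
      (by rw [Measure.smul_apply, hν, smul_zero]) (by rwa [energy_smul hG hr])
    simpa using h
  by_cases h0 : energy G r ν = 0
  · have hz : ν univ = 0 := by
      by_contra hne
      have h1 : ∀ n : ℕ, (n : ℝ≥0∞) * ν univ ≤ maxMass G r K := fun n =>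
        key n (ENNReal.natCast_ne_top n) (by simp [h0])
      obtain ⟨n, hn⟩ := ENNReal.exists_nat_mul_gt hne ht
      exact absurd (h1 n) (not_le.2 hn)
    simp [hz, hr0]
  · have h1 := key (energy G r ν ^ (-1 / r))
      (by rw [ne_eq, ENNReal.rpow_eq_top_iff]; simp [h0, hE]) (by
        rw [← ENNReal.rpow_mul, div_mul_cancel₀ _ hr0.ne', ENNReal.rpow_neg_one,
          ENNReal.inv_mul_cancel h0 hE])
    have h2 := ENNReal.rpow_le_rpow h1 hr0.le
    rw [ENNReal.mul_rpow_of_nonneg _ _ hr0.le, ← ENNReal.rpow_mul, div_mul_cancel₀ _ hr0.ne',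
      ENNReal.rpow_neg_one, mul_comm, ← div_eq_mul_inv,
      ENNReal.div_le_iff_le_mul (Or.inl h0) (Or.inl hE)] at h2
    exact h2

/-- The variational inequality satisfied by an extremal measure. -/
theorem div_maxMass_le_lintegral_pot (hG : IsKernelFamily G) (hr : 1 < r) {K : Set X}
    (hK : IsCompact K) (h0 : maxMass G r K ≠ 0) (ht : maxMass G r K ≠ ⊤)
    (μ : Measure X) [IsLocallyFiniteMeasure μ] (hμK : μ Kᶜ = 0) (hμ : μ univ = maxMass G r K)
    (hμE : energy G r μ ≤ 1)
    (ν : Measure X) [IsLocallyFiniteMeasure ν] (hν : ν Kᶜ = 0) (hE : energy G r ν ≠ ⊤) :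
    ν univ / maxMass G r K ≤ ∫⁻ z, pot G r μ z ∂ν := by
  have hr0 : 0 < r := by linarith
  set M := maxMass G r K with hM
  set x := coeff G μ with hx
  set y := coeff G ν with hy
  have hEμ : ∑' i, x i ^ r ≤ 1 := by rwa [← energy_eq_tsum hG hr]
  have hEν : ∑' i, y i ^ r ≠ ⊤ := by rwa [← energy_eq_tsum hG hr]
  have hsum : ∑' i, (x i + y i) ^ r ≠ ⊤ := by
    refine ne_top_of_le_ne_top ?_ (ENNReal.tsum_le_tsum fun i =>
      ENNReal.rpow_add_le_mul_rpow_add_rpow (x i) (y i) hr.le)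
    rw [ENNReal.tsum_mul_left, ENNReal.tsum_add]
    exact ENNReal.mul_ne_top (ENNReal.rpow_ne_top_of_nonneg (by linarith) ENNReal.ofNat_ne_top)
      (ENNReal.add_ne_top.2 ⟨ne_top_of_le_ne_top ENNReal.one_ne_top hEμ, hEν⟩)
  have hdom : ∀ s : ℝ≥0∞, s ≤ 1 → ∀ i, y i * (x i + s * y i) ^ (r - 1) ≤ (x i + y i) ^ r := by
    intro s hs i
    rw [← rpow_sub_one_mul_self hr, mul_comm]
    have h1 : x i + s * y i ≤ x i + y i := by
      gcongr; exact mul_le_of_le_one_left bot_le hs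
    exact mul_le_mul' (ENNReal.rpow_le_rpow h1 (by linarith)) le_add_self
  -- Extremality gives $(1+s\,\nu(X)/M)^r\le\mathcal E(\mu+s\nu)$. Bernoulli bounds the left side
  -- below, the tangent line bounds the right side above, and the common factor $rs$ cancels.
  have hstep : ∀ s : ℝ≥0∞, s ≠ 0 → s ≤ 1 →
      ν univ / M ≤ ∑' i, y i * (x i + s * y i) ^ (r - 1) := by
    intro s hs0 hs1
    have hst : s ≠ ⊤ := ne_top_of_le_ne_top ENNReal.one_ne_top hs1
    have hνf := isFiniteMeasure_of_compl_null hK ν hν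
    have hμf := isFiniteMeasure_of_compl_null hK μ hμK
    have := Measure.smul_finite ν hst
    have hσ : energy G r (μ + s • ν) = ∑' i, (x i + s * y i) ^ r := by
      rw [energy_eq_tsum hG hr]
      exact tsum_congr fun i => by rw [coeff_add, coeff_smul]
    have hσt : energy G r (μ + s • ν) ≠ ⊤ := by
      rw [hσ]
      refine ne_top_of_le_ne_top hsum (ENNReal.tsum_le_tsum fun i => ?_)
      gcongr
      exact mul_le_of_le_one_left bot_le hs1
    have h1 := measure_univ_rpow_le hG hr hK ht (μ + s • ν)
      (by rw [Measure.add_apply, Measure.smul_apply, hμK, hν]; simp) hσt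
    rw [Measure.add_apply, Measure.smul_apply, smul_eq_mul, hμ] at h1
    have e1 : M + s * ν univ = M * (1 + s * (ν univ / M)) := by
      rw [mul_add, mul_one, mul_left_comm, ENNReal.mul_div_cancel h0 ht]
    rw [e1, ENNReal.mul_rpow_of_nonneg _ _ hr0.le] at h1
    have h2 : (1 + s * (ν univ / M)) ^ r ≤ energy G r (μ + s • ν) :=
      (ENNReal.mul_le_mul_iff_right (by simp [h0, hr0, ht])
        (ENNReal.rpow_ne_top_of_nonneg hr0.le ht)).1 h1
    have h3 : energy G r (μ + s • ν) ≤
        1 + ENNReal.ofReal r * (s * ∑' i, y i * (x i + s * y i) ^ (r - 1)) := by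
      rw [hσ]
      refine (ENNReal.tsum_le_tsum fun i => add_rpow_le hr (x i) (s * y i)).trans ?_
      rw [ENNReal.tsum_add, ENNReal.tsum_mul_left]
      simp only [mul_assoc, ENNReal.tsum_mul_left]
      gcongr
    have h4 := ((one_add_mul_le_rpow_one_add hr _).trans h2).trans h3
    rw [ENNReal.add_le_add_iff_left ENNReal.one_ne_top,
      ENNReal.mul_le_mul_iff_right (by simpa using hr0) ENNReal.ofReal_ne_top,
      ENNReal.mul_le_mul_iff_right hs0 hst] at h4
    exact h4
  have hlim : Tendsto (fun n : ℕ => ∑' i, y i * (x i + ((n : ℝ≥0∞) + 1)⁻¹ * y i) ^ (r - 1)) atTop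
      (𝓝 (∑' i, y i * x i ^ (r - 1))) := by
    refine tendsto_tsum_of_dominated hsum (fun n i => hdom _ ?_ i) fun i => ?_
    · exact ENNReal.inv_le_one.2 le_add_self
    · have hs : Tendsto (fun n : ℕ => ((n : ℝ≥0∞) + 1)⁻¹) atTop (𝓝 0) := by
        have := (tendsto_add_atTop_iff_nat 1).2 ENNReal.tendsto_inv_nat_nhds_zero
        simpa using this
      have hyt : y i ≠ ⊤ := coeff_ne_top hG ν i
      refine ENNReal.Tendsto.const_mul ?_ (Or.inr hyt)
      refine (ENNReal.continuous_rpow_const.tendsto _).comp ?_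
      have := (ENNReal.Tendsto.mul_const hs (Or.inr hyt)).const_add (x i)
      simpa using this
  have hfin := ge_of_tendsto' hlim fun n => hstep ((n : ℝ≥0∞) + 1)⁻¹
    (ENNReal.inv_ne_zero.2 (by simp)) (ENNReal.inv_le_one.2 le_add_self)
  rw [pot, lintegral_synth hG]
  simpa only [mul_comm] using hfin

/-- A measure of mass and energy `c` whose potential is at least `1` quasi-everywhere on `E` and at
most `1` on the support of the measure. -/
structure IsEquilibrium (G : ι → X → ℝ) (r : ℝ) (E : Set X) (c : ℝ≥0∞) (γ : Measure X) : Prop where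
  isLocallyFinite : IsLocallyFiniteMeasure γ
  mass : γ univ = c
  energy_eq : energy G r γ = c
  one_le : rootCap G r {z ∈ E | ¬ 1 ≤ pot G r γ z} = 0
  le_one : ∀ z ∈ γ.support, pot G r γ z ≤ 1

theorem exists_isEquilibrium_of_isCompact (hG : IsKernelFamily G) (hqr : q.HolderConjugate r)
    {K : Set X} (hK : IsCompact K) (h0 : maxMass G r K ≠ 0) (ht : maxMass G r K ≠ ⊤) :
    ∃ γ, IsEquilibrium G r K (maxMass G r K ^ q) γ ∧ γ Kᶜ = 0 := by
  have hr : 1 < r := hqr.symm.lt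
  obtain ⟨μ, hμreg, hμK, hμ, hμE⟩ := exists_maximiser hG hr hK h0 ht
  have hμf := isFiniteMeasure_of_compl_null hK μ hμK
  have hvar := fun (ν : Measure X) (_ : IsLocallyFiniteMeasure ν) (h2 : ν Kᶜ = 0)
    (h3 : energy G r ν ≠ ⊤) =>
    div_maxMass_le_lintegral_pot hG hr hK h0 ht μ hμK hμ hμE ν h2 h3
  set M := maxMass G r K with hM
  have hM0 : M⁻¹ ≠ 0 := ENNReal.inv_ne_zero.2 ht
  have hMt : M⁻¹ ≠ ⊤ := ENNReal.inv_ne_top.2 h0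
  -- A finite-energy measure living where the potential is at most $t<1/M$ would violate the
  -- variational inequality unless it vanishes.
  have hnull : ∀ t < M⁻¹, ∀ ν : Measure X, IsLocallyFiniteMeasure ν →
      ν (K ∩ {z | pot G r μ z ≤ t})ᶜ = 0 → energy G r ν ≠ ⊤ → ν univ = 0 := by
    intro t htM ν hν1 hν2 hν3
    have hνK : ν Kᶜ = 0 := measure_mono_null (compl_subset_compl.2 inter_subset_left) hν2
    have hνf := isFiniteMeasure_of_compl_null hK ν hνK
    have h1 := hvar ν hν1 hνK hν3
    have h2 : ∫⁻ z, pot G r μ z ∂ν ≤ t * ν univ := by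
      rw [← lintegral_const]
      refine lintegral_mono_ae ?_
      filter_upwards [show ∀ᵐ x ∂ν, x ∈ K ∩ {z | pot G r μ z ≤ t} from hν2] with x hx using hx.2
    by_contra hne
    have h3 := h1.trans h2
    rw [div_eq_mul_inv, mul_comm,
      ENNReal.mul_le_mul_iff_left hne (measure_ne_top ν _)] at h3
    exact absurd htM (not_lt.2 h3)
  obtain ⟨t, -, htM, htlim⟩ := exists_seq_strictMono_tendsto' (pos_iff_ne_zero.2 hM0)
  have hcover : ∀ z ∈ K, ¬ M⁻¹ ≤ pot G r μ z → ∃ k, z ∈ K ∩ {z | pot G r μ z ≤ t k} := by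
    intro z hz hlt
    obtain ⟨k, hk⟩ := (htlim.eventually_const_lt (not_le.1 hlt)).exists
    exact ⟨k, hz, hk.le⟩
  have hcl : ∀ k, IsClosed {z | pot G r μ z ≤ t k} := fun k => isClosed_synth_le hG _ _
  have hquasi : rootCap G r {z ∈ K | ¬ M⁻¹ ≤ pot G r μ z} = 0 := by
    refine rootCap_null_mono (F := ⋃ k, K ∩ {z | pot G r μ z ≤ t k})
      (fun z hz => mem_iUnion.2 (hcover z hz.1 hz.2)) (rootCap_iUnion_null hG hr fun k => ?_)
    rw [rootCap_of_isCompact hG hr (hK.inter_right (hcl k))]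
    exact le_antisymm (maxMass_le fun ν h1 h2 h3 =>
      (hnull (t k) (htM k).2 ν h1 h2 (ne_top_of_le_ne_top ENNReal.one_ne_top h3)).le) bot_le
  have hae : ∀ᵐ z ∂μ, M⁻¹ ≤ pot G r μ z := by
    have h1 : μ (⋃ k, K ∩ {z | pot G r μ z ≤ t k}) = 0 := by
      refine measure_iUnion_null fun k => ?_
      have hms : MeasurableSet (K ∩ {z | pot G r μ z ≤ t k}) :=
        hK.measurableSet.inter (hcl k).measurableSet
      have := hnull (t k) (htM k).2 (μ.restrict (K ∩ {z | pot G r μ z ≤ t k})) inferInstance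
        (by rw [Measure.restrict_apply hms.compl]; simp)
        (ne_top_of_le_ne_top ENNReal.one_ne_top
          ((energy_mono hG hr Measure.restrict_le_self).trans hμE))
      simpa using this
    filter_upwards [show ∀ᵐ x ∂μ, x ∈ K from hμK,
      measure_eq_zero_iff_ae_notMem.1 h1] with z hzK hz
    by_contra hcon
    exact hz (mem_iUnion.2 (hcover z hzK hcon))
  have hone : ∫⁻ _, M⁻¹ ∂μ = 1 := by
    rw [lintegral_const, hμ, ENNReal.inv_mul_cancel h0 ht]
  -- Both sides have integral at most `1` against `μ`, and the smaller one attains it.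
  have heq : (fun _ => M⁻¹) =ᵐ[μ] pot G r μ :=
    ae_eq_of_ae_le_of_lintegral_le hae (by rw [hone]; exact ENNReal.one_ne_top)
      (measurable_synth hG _).aemeasurable (by rw [hone]; exact hμE)
  have hE1 : energy G r μ = 1 := by
    rw [energy, ← lintegral_congr_ae heq, hone]
  have hsupp : ∀ z ∈ μ.support, pot G r μ z ≤ M⁻¹ := by
    have h1 : μ {z | M⁻¹ < pot G r μ z} = 0 := by
      rw [measure_eq_zero_iff_ae_notMem]
      filter_upwards [heq] with z hz
      simpa using hz.ge
    intro z hz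
    by_contra hcon
    exact Measure.subset_compl_support_of_isOpen (isOpen_lt_synth hG _ _) h1
      (show z ∈ {z | M⁻¹ < pot G r μ z} from not_le.1 hcon) hz
  -- Since $(q-1)(r-1)=1$, the factor $M^{q-1}$ multiplies the potential by $M$ and turns the mass
  -- $M$ into $M^q$.
  have hc : M ^ (q - 1) ≠ ⊤ := ENNReal.rpow_ne_top_of_nonneg hqr.sub_one_pos.le ht
  have hpot : ∀ z, pot G r (M ^ (q - 1) • μ) z = M * pot G r μ z := fun z => by
    rw [pot_smul hr, ← ENNReal.rpow_mul,
      show (q - 1) * (r - 1) = 1 by linarith [hqr.sub_one_mul_conj], ENNReal.rpow_one]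
  have hMM : M * M⁻¹ = 1 := ENNReal.mul_inv_cancel h0 ht
  refine ⟨M ^ (q - 1) • μ, ⟨?_, ?_, ?_, ?_, ?_⟩, by simp [hμK]⟩
  · have := Measure.smul_finite μ hc
    infer_instance
  · rw [Measure.smul_apply, smul_eq_mul, hμ, rpow_sub_one_mul_self hqr.lt]
  · rw [energy_smul hG hr, hE1, mul_one, ← ENNReal.rpow_mul, hqr.sub_one_mul_conj]
  · refine rootCap_null_mono (F := {z ∈ K | ¬ M⁻¹ ≤ pot G r μ z}) ?_ hquasi
    refine fun z hz => ⟨hz.1, fun hle => hz.2 ?_⟩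
    rw [hpot, ← hMM]
    gcongr
  · intro z hz
    rw [hpot, ← hMM]
    gcongr
    exact hsupp z (Measure.AbsolutelyContinuous.support_mono
      Measure.smul_absolutelyContinuous hz)

/-! ### Uniform convexity of $\ell^q$ -/

section UniformConvexity

theorem two_le_rpow_add_rpow (hq : 1 < q) {s : ℝ} (h0 : 0 ≤ s) (h1 : s ≤ 1) :
    2 ≤ (1 + s) ^ q + (1 - s) ^ q := by
  have ha := one_add_mul_self_le_rpow_one_add (s := s) (by linarith) hq.le
  have hb := one_add_mul_self_le_rpow_one_add (s := -s) (by linarith) hq.le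
  rw [← sub_eq_add_neg] at hb
  linarith

theorem two_lt_rpow_add_rpow (hq : 1 < q) {s : ℝ} (h0 : 0 < s) (h1 : s ≤ 1) :
    2 < (1 + s) ^ q + (1 - s) ^ q := by
  have ha := one_add_mul_self_lt_rpow_one_add (s := s) (by linarith) h0.ne' hq
  have hb := one_add_mul_self_le_rpow_one_add (s := -s) (by linarith) hq.le
  rw [← sub_eq_add_neg] at hb
  linarith

/-- The normalized case of midpoint `1` and endpoints `1 ± s`. If $(2s)^q<2\varepsilon$, the term
with $\varepsilon$ suffices; the other `s` form a compact set avoiding `0`, where strict convexity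
leaves a positive gap. -/
theorem exists_uniform_convexity_one (hq : 1 < q) {ε : ℝ} (hε : 0 < ε) :
    ∃ C : ℝ, 0 ≤ C ∧ ∀ s : ℝ, 0 ≤ s → s ≤ 1 →
      (2 * s) ^ q + C ≤ (ε + C / 2) * ((1 + s) ^ q + (1 - s) ^ q) := by
  have hq0 : 0 < q := by linarith
  have hcont : Continuous fun s : ℝ => (2 * s) ^ q :=
    (continuous_const.mul continuous_id).rpow_const fun _ => Or.inr hq0.le
  have hS : Continuous fun s : ℝ => (1 + s) ^ q + (1 - s) ^ q :=
    ((continuous_const.add continuous_id).rpow_const fun _ => Or.inr hq0.le).add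
      ((continuous_const.sub continuous_id).rpow_const fun _ => Or.inr hq0.le)
  have hT : IsCompact (Icc (0 : ℝ) 1 ∩ {s | 2 * ε ≤ (2 * s) ^ q}) :=
    isCompact_Icc.inter_right (isClosed_le continuous_const hcont)
  have hsmall : ∀ C : ℝ, 0 ≤ C → ∀ s : ℝ, 0 ≤ s → s ≤ 1 → (2 * s) ^ q < 2 * ε →
      (2 * s) ^ q + C ≤ (ε + C / 2) * ((1 + s) ^ q + (1 - s) ^ q) := by
    intro C hC s h0 h1 hlt
    have h2 := two_le_rpow_add_rpow hq h0 h1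
    have := mul_le_mul_of_nonneg_left h2 (show 0 ≤ ε + C / 2 by positivity)
    linarith
  rcases eq_empty_or_nonempty (Icc (0 : ℝ) 1 ∩ {s | 2 * ε ≤ (2 * s) ^ q}) with hemp | hne
  · refine ⟨0, le_rfl, fun s h0 h1 => hsmall 0 le_rfl s h0 h1 ?_⟩
    by_contra hcon
    exact (hemp.subset ⟨⟨h0, h1⟩, not_lt.1 hcon⟩).elim
  · obtain ⟨s₀, ⟨⟨h00, h01⟩, hs₀⟩, hmin⟩ := hT.exists_isMinOn hne hS.continuousOn
    have hs₀pos : 0 < s₀ := by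
      rcases h00.eq_or_lt with h | h
      · rw [← h] at hs₀
        simp only [mem_ofPred_eq, mul_zero, Real.zero_rpow hq0.ne'] at hs₀
        linarith
      · exact h
    have hm := two_lt_rpow_add_rpow hq hs₀pos h01
    set m := (1 + s₀) ^ q + (1 - s₀) ^ q - 2 with hmdef
    have hmpos : 0 < m := by linarith
    -- With `m` the minimal gap, this constant satisfies $Cm/2=2^q\ge(2s)^q$.
    have hC : (0 : ℝ) ≤ 2 * 2 ^ q / m := by positivity
    refine ⟨2 * 2 ^ q / m, hC, fun s h0 h1 => ?_⟩
    rcases lt_or_ge ((2 * s) ^ q) (2 * ε) with hlt | hge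
    · exact hsmall _ hC s h0 h1 hlt
    · have h2 : m + 2 ≤ (1 + s) ^ q + (1 - s) ^ q := by
        have h2 : (1 + s₀) ^ q + (1 - s₀) ^ q ≤ (1 + s) ^ q + (1 - s) ^ q :=
          hmin ⟨⟨h0, h1⟩, hge⟩
        linarith
      have h3 : (2 * s) ^ q ≤ 2 ^ q := Real.rpow_le_rpow (by positivity) (by linarith) hq0.le
      have h4 := mul_le_mul_of_nonneg_left h2
        (show 0 ≤ ε + 2 * 2 ^ q / m / 2 by positivity)
      have h5 : (ε + 2 * 2 ^ q / m / 2) * (m + 2) = ε * (m + 2) + 2 ^ q + 2 * 2 ^ q / m := by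
        field_simp
        ring
      have h6 : 0 < ε * (m + 2) := by positivity
      linarith

theorem exists_uniform_convexity_real (hq : 1 < q) {ε : ℝ} (hε : 0 < ε) :
    ∃ C : ℝ, 0 ≤ C ∧ ∀ a b : ℝ, 0 ≤ b → b ≤ a →
      (a - b) ^ q + C * ((a + b) / 2) ^ q ≤ (ε + C / 2) * (a ^ q + b ^ q) := by
  obtain ⟨C, hC, h⟩ := exists_uniform_convexity_one hq hε
  have hq0 : q ≠ 0 := by linarith
  refine ⟨C, hC, fun a b hb hba => ?_⟩
  rcases (hb.trans hba).eq_or_lt with ha | ha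
  · have hb' : b = 0 := by linarith
    simp [← ha, hb', Real.zero_rpow hq0]
  · have hs0 : 0 ≤ (a - b) / (a + b) := div_nonneg (by linarith) (by linarith)
    have hs1 : (a - b) / (a + b) ≤ 1 := (div_le_one (by linarith)).2 (by linarith)
    have key := mul_le_mul_of_nonneg_left (h _ hs0 hs1)
      (show 0 ≤ ((a + b) / 2) ^ q by positivity)
    have hm : 0 ≤ (a + b) / 2 := by positivity
    have hab : a + b ≠ 0 := by positivity
    rw [mul_add, ← Real.mul_rpow hm (by positivity), mul_left_comm _ (ε + C / 2),
      mul_add (((a + b) / 2) ^ q),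
      ← Real.mul_rpow hm (by positivity), ← Real.mul_rpow hm (by linarith)] at key
    have e1 : (a + b) / 2 * (2 * ((a - b) / (a + b))) = a - b := by field_simp
    have e2 : (a + b) / 2 * (1 + (a - b) / (a + b)) = a := by field_simp; ring
    have e3 : (a + b) / 2 * (1 - (a - b) / (a + b)) = b := by field_simp; ring
    rw [e1, e2, e3] at key
    linarith

theorem exists_uniform_convexity (hq : 1 < q) {ε : NNReal} (hε : 0 < ε) :
    ∃ C : NNReal, ∀ a b : ℝ≥0∞, a ≠ ⊤ → b ≠ ⊤ →
      (a - b) ^ q + C * ((a + b) / 2) ^ q ≤ (ε + C / 2) * (a ^ q + b ^ q) := by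
  obtain ⟨C, hC, h⟩ := exists_uniform_convexity_real hq (NNReal.coe_pos.2 hε)
  have hq0 : 0 < q := by linarith
  lift C to NNReal using hC
  refine ⟨C, fun a b ha hb => ?_⟩
  lift a to NNReal using ha
  lift b to NNReal using hb
  have key : (a - b) ^ q + C * ((a + b) / 2) ^ q ≤
      (ε + C / 2) * (a ^ q + b ^ q) := by
    rw [← NNReal.coe_le_coe]
    push_cast
    rcases le_total b a with hba | hab
    · rw [NNReal.coe_sub hba]
      exact h a b b.coe_nonneg (by exact_mod_cast hba)
    -- Here the truncated difference is zero, and the real inequality with `a` and `b` exchanged is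
    -- stronger.
    · rw [tsub_eq_zero_of_le hab, NNReal.coe_zero, Real.zero_rpow hq0.ne', zero_add]
      have := h b a a.coe_nonneg (by exact_mod_cast hab)
      rw [add_comm (b : ℝ), add_comm ((b : ℝ) ^ q)] at this
      have h0 : (0 : ℝ) ≤ ((b : ℝ) - a) ^ q :=
        Real.rpow_nonneg (sub_nonneg.2 (by exact_mod_cast hab)) _
      linarith
  have key' := ENNReal.coe_le_coe.2 key
  simpa only [ENNReal.coe_add, ENNReal.coe_mul, ENNReal.coe_sub, ENNReal.coe_div two_ne_zero,
    ENNReal.coe_rpow_of_nonneg _ hq0.le, ENNReal.coe_ofNat] using key'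

/-- Nearly minimal norms with nearly minimal midpoints force a Cauchy property. Letting `m` tend to
infinity along `l` (Fatou) and then `n`, the bound tends to `δ * (c + c)`: the terms with `C`
cancel. -/
theorem tendsto_tsum_sub_rpow (hq : 1 < q) {F : ℕ → ι → ℝ≥0∞} {f : ι → ℝ≥0∞} {l : Filter ℕ}
    [l.NeBot] (hl : l ≤ atTop) (hF : ∀ n i, F n i ≠ ⊤)
    (hlim : ∀ i, Tendsto (fun n => F n i) l (𝓝 (f i))) {e b : ℕ → ℝ≥0∞} {c : ℝ≥0∞} (hc : c ≠ ⊤)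
    (he : ∀ n, e n ≠ ⊤) (hb : ∀ n, b n ≠ ⊤) (hFe : ∀ n, ∑' i, F n i ^ q = e n)
    (hec : Tendsto e atTop (𝓝 c)) (hbc : Tendsto b atTop (𝓝 c))
    (hmid : ∀ n m, n ≤ m → b n ≤ ∑' i, ((F n i + F m i) / 2) ^ q) :
    Tendsto (fun n => ∑' i, (F n i - f i) ^ q) atTop (𝓝 0) := by
  rw [ENNReal.tendsto_nhds_zero]
  intro ε hε
  obtain ⟨δ, hδ, hδε⟩ := ENNReal.exists_nnreal_pos_mul_lt (a := c + c)
    (ENNReal.add_ne_top.2 ⟨hc, hc⟩) hε.ne'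
  obtain ⟨C, hC⟩ := exists_uniform_convexity hq hδ
  have hA : (δ : ℝ≥0∞) + C / 2 ≠ ⊤ :=
    ENNReal.add_ne_top.2 ⟨ENNReal.coe_ne_top, (ENNReal.div_lt_top ENNReal.coe_ne_top two_ne_zero).ne⟩
  have h1 : ∀ n m, n ≤ m →
      ∑' i, (F n i - F m i) ^ q ≤ (δ + C / 2) * (e n + e m) - C * b n := by
    intro n m hnm
    refine ENNReal.le_sub_of_add_le_right (ENNReal.mul_ne_top ENNReal.coe_ne_top (hb n)) ?_
    calc ∑' i, (F n i - F m i) ^ q + C * b n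
        ≤ ∑' i, (F n i - F m i) ^ q + C * ∑' i, ((F n i + F m i) / 2) ^ q := by
          gcongr; exact hmid n m hnm
      _ = ∑' i, ((F n i - F m i) ^ q + C * ((F n i + F m i) / 2) ^ q) := by
          rw [ENNReal.tsum_add, ENNReal.tsum_mul_left]
      _ ≤ ∑' i, (δ + C / 2) * (F n i ^ q + F m i ^ q) :=
          ENNReal.tsum_le_tsum fun i => hC _ _ (hF n i) (hF m i)
      _ = _ := by rw [ENNReal.tsum_mul_left, ENNReal.tsum_add, hFe, hFe]
  have h2 : ∀ n, ∑' i, (F n i - f i) ^ q ≤ (δ + C / 2) * (e n + c) - C * b n := by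
    intro n
    refine tsum_le_of_tendsto (l := l) (f := fun m i => (F n i - F m i) ^ q) (fun i => ?_) ?_
      ((eventually_ge_atTop n).filter_mono hl |>.mono fun m hm => h1 n m hm)
    · exact (ENNReal.continuous_rpow_const.tendsto _).comp
        (ENNReal.Tendsto.sub tendsto_const_nhds (hlim i) (Or.inl (hF n i)))
    · refine ENNReal.Tendsto.sub (ENNReal.Tendsto.const_mul ((hec.mono_left hl).const_add _)
        (Or.inr hA)) tendsto_const_nhds (Or.inl ?_)
      exact ENNReal.mul_ne_top hA (ENNReal.add_ne_top.2 ⟨he n, hc⟩)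
  have h3 : Tendsto (fun n => ((δ : ℝ≥0∞) + C / 2) * (e n + c) - C * b n) atTop
      (𝓝 ((δ + C / 2) * (c + c) - C * c)) := by
    refine ENNReal.Tendsto.sub (ENNReal.Tendsto.const_mul (hec.add_const _) (Or.inr hA))
      (ENNReal.Tendsto.const_mul hbc (Or.inr ENNReal.coe_ne_top)) (Or.inl ?_)
    exact ENNReal.mul_ne_top hA (ENNReal.add_ne_top.2 ⟨hc, hc⟩)
  have h4 : ((δ : ℝ≥0∞) + C / 2) * (c + c) - C * c = δ * (c + c) := by
    have : ((C : ℝ≥0∞) / 2) * (c + c) = C * c := by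
      rw [← two_mul, ← mul_assoc, ENNReal.div_mul_cancel two_ne_zero ENNReal.ofNat_ne_top]
    rw [add_mul, this, ENNReal.add_sub_cancel_right (ENNReal.mul_ne_top ENNReal.coe_ne_top hc)]
  rw [h4] at h3
  exact (h3.eventually_lt_const hδε).mono fun n hn => (h2 n).trans hn.le

end UniformConvexity

/-! ### Equilibrium measures of open and arbitrary sets -/

section Equilibrium

theorem tsum_coeff_rpow (hG : IsKernelFamily G) (hqr : q.HolderConjugate r) (μ : Measure X) :
    ∑' i, (coeff G μ i ^ (r - 1)) ^ q = energy G r μ := by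
  rw [energy_eq_tsum hG hqr.symm.lt]
  exact tsum_congr fun i => by rw [← ENNReal.rpow_mul, hqr.symm.sub_one_mul_conj]

theorem rootCap_rpow_le (hG : IsKernelFamily G) (hqr : q.HolderConjugate r)
    {f : ι → ℝ≥0∞} {E : Set X} (h : rootCap G r {z ∈ E | ¬ 1 ≤ synth G f z} = 0) :
    rootCap G r E ^ q ≤ ∑' i, f i ^ q := by
  have := ENNReal.rpow_le_rpow (rootCap_le_of_one_le_synth hG hqr h) hqr.nonneg
  rwa [← ENNReal.rpow_mul, one_div_mul_cancel hqr.ne_zero, ENNReal.rpow_one] at this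

/-- The value `c` stays that of the larger set: measures of open neighbourhoods can thus be viewed
on `E` before their masses converge to the capacity of `E`. -/
theorem IsEquilibrium.mono {E F : Set X} {c : ℝ≥0∞} {γ : Measure X}
    (h : IsEquilibrium G r F c γ) (hEF : E ⊆ F) : IsEquilibrium G r E c γ :=
  { h with one_le := rootCap_null_mono (F := {z ∈ F | ¬ 1 ≤ pot G r γ z}) (fun _ hz => ⟨hEF hz.1, hz.2⟩) h.one_le }

theorem exists_isEquilibrium_limit (hG : IsKernelFamily G) (hqr : q.HolderConjugate r)
    {E : ℕ → Set X} (hE : Monotone E) {μ : ℕ → Measure X} {e : ℕ → ℝ≥0∞}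
    (h : ∀ n, IsEquilibrium G r (E n) (e n) (μ n)) (he : ∀ n, e n ≠ ⊤) {c : ℝ≥0∞} (hc : c ≠ ⊤)
    (hec : Tendsto e atTop (𝓝 c)) (hcap : Tendsto (fun n => rootCap G r (E n) ^ q) atTop (𝓝 c))
    {F : ℕ → Set X} (hFc : ∀ k, IsClosed (F k)) (hF : ∀ k, ∀ᶠ n in atTop, μ n (F k)ᶜ = 0) :
    ∃ γ, IsEquilibrium G r (⋃ n, E n) c γ ∧ ∀ k, γ (F k)ᶜ = 0 := by
  have hr : 1 < r := hqr.symm.lt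
  obtain ⟨B, hB⟩ := ((ENNReal.tendsto_toNNReal hc).comp hec).bddAbove_range
  have hmass : ∀ n, μ n univ ≤ (B : ℝ≥0∞) := fun n => by
    rw [(h n).mass, ← ENNReal.coe_toNNReal (he n)]
    exact ENNReal.coe_le_coe.2 (hB ⟨n, rfl⟩)
  have hloc := fun n => (h n).isLocallyFinite
  have hU : (Ultrafilter.of (atTop : Filter ℕ) : Filter ℕ) ≤ atTop := Ultrafilter.of_le _
  obtain ⟨γ, hγ, hv⟩ :=
    exists_vagueTendsto μ (Ultrafilter.of atTop) B ENNReal.coe_ne_top hmass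
  set f : ℕ → ι → ℝ≥0∞ := fun n i => coeff G (μ n) i ^ (r - 1) with hf
  have hFe : ∀ n, ∑' i, f n i ^ q = e n := fun n => by
    rw [← (h n).energy_eq, ← tsum_coeff_rpow hG hqr]
  -- Both potentials are at least `1` quasi-everywhere on the smaller set `E n`, hence so is their
  -- average.
  have hmid : ∀ n m, n ≤ m →
      rootCap G r (E n) ^ q ≤ ∑' i, ((f n i + f m i) / 2) ^ q := by
    intro n m hnm
    refine rootCap_rpow_le hG hqr (rootCap_null_mono
      (F := {z ∈ E n | ¬ 1 ≤ pot G r (μ n) z} ∪ {z ∈ E m | ¬ 1 ≤ pot G r (μ m) z}) ?_ ?_)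
    · rintro z ⟨hz, h1⟩
      by_contra hcon
      simp only [mem_union, mem_ofPred_eq, not_or, not_and, not_not] at hcon
      refine h1 ?_
      have e1 : synth G (fun i => (f n i + f m i) / 2) z =
          2⁻¹ * (pot G r (μ n) z + pot G r (μ m) z) := by
        rw [pot, pot, ← synth_add, ← synth_const_mul]
        simp only [div_eq_mul_inv, mul_comm, hf]
      rw [e1]
      calc (1 : ℝ≥0∞) = 2⁻¹ * (1 + 1) := by
            rw [one_add_one_eq_two, ENNReal.inv_mul_cancel two_ne_zero ENNReal.ofNat_ne_top]
        _ ≤ _ := by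
            gcongr
            · exact hcon.1 hz
            · exact hcon.2 (hE hnm hz)
    · exact le_antisymm ((rootCap_union_le hG hr _ _).trans
        (by rw [(h n).one_le, (h m).one_le, add_zero])) bot_le
  have hcapt : ∀ n, rootCap G r (E n) ^ q ≠ ⊤ := fun n =>
    ne_top_of_le_ne_top (he n) ((rootCap_rpow_le hG hqr (h n).one_le).trans (hFe n).le)
  have hstrong := tendsto_tsum_sub_rpow hqr.lt (F := f)
    (f := fun i => coeff G γ i ^ (r - 1)) hU
    (fun n i => ENNReal.rpow_ne_top_of_nonneg (by linarith) (coeff_ne_top hG (μ n) i))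
    (fun i => (ENNReal.continuous_rpow_const.tendsto _).comp (hv.coeff hG i))
    hc he hcapt hFe hec hcap hmid
  have hquasi : ∀ k, rootCap G r {z ∈ E k | ¬ 1 ≤ pot G r γ z} = 0 := fun k => by
    refine rootCap_one_le_synth_of_approx hG hqr (F := f) ?_ hstrong
    filter_upwards [eventually_ge_atTop k] with n hn
    exact rootCap_null_mono (F := {z ∈ E n | ¬ 1 ≤ pot G r (μ n) z})
      (fun z hz => ⟨hE hn hz.1, hz.2⟩) (h n).one_le
  -- The upper bound is Fatou; the lower bound holds because the coefficients of `γ` are admissible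
  -- for every `E k`.
  have hen : energy G r γ = c := by
    refine le_antisymm (hv.energy_le hG hr (hec.mono_left hU)
      (Eventually.of_forall fun n => (h n).energy_eq.le)) (le_of_tendsto' hcap fun k => ?_)
    rw [← tsum_coeff_rpow hG hqr]
    exact rootCap_rpow_le hG hqr (hquasi k)
  have hle : ∀ z ∈ γ.support, pot G r γ z ≤ 1 := hv.pot_le hG hr fun n => (h n).le_one
  refine ⟨γ, ⟨inferInstance, le_antisymm ?_ ?_, hen, ?_, hle⟩, fun k => ?_⟩
  · refine le_of_forall_gt_imp_ge_of_dense fun a ha => hv.measure_le isOpen_univ ?_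
    filter_upwards [(hec.mono_left hU).eventually_lt_const ha] with n hn
    rw [(h n).mass]
    exact hn.le
  -- No mass escapes to infinity: the potential is at most `1` on the support, so the mass is at
  -- least the energy `c`.
  · rw [← hen, energy, ← lintegral_one]
    refine lintegral_mono_ae ?_
    filter_upwards [Measure.support_mem_ae (μ := γ)] with z hz using hle z hz
  · refine rootCap_null_mono (F := ⋃ k, {z ∈ E k | ¬ 1 ≤ pot G r γ z}) ?_
      (rootCap_iUnion_null hG hr hquasi)
    rintro z ⟨hz, h1⟩
    obtain ⟨k, hk⟩ := mem_iUnion.1 hz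
    exact mem_iUnion.2 ⟨k, hk, h1⟩
  · exact le_antisymm (hv.measure_le (hFc k).isOpen_compl
      (((hF k).filter_mono hU).mono fun n hn => hn.le)) bot_le

theorem exists_isEquilibrium_of_isOpen (hG : IsKernelFamily G) (hqr : q.HolderConjugate r)
    {V : Set X} (hV : IsOpen V) (h0 : innerMass G r V ≠ 0) (ht : innerMass G r V ≠ ⊤) :
    ∃ γ, IsEquilibrium G r V (innerMass G r V ^ q) γ ∧ γ (closure V)ᶜ = 0 := by
  have hr : 1 < r := hqr.symm.lt
  obtain ⟨u, -, hu, hlim⟩ := exists_seq_strictMono_tendsto' (pos_iff_ne_zero.2 h0)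
  have hex : ∀ n, ∃ K, IsCompact K ∧ K ⊆ V ∧ u n < maxMass G r K := by
    intro n
    by_contra! hcon
    exact absurd (hu n).2 (not_lt.2 (innerMass_le hcon))
  choose L hLc hLV hLu using hex
  obtain ⟨A, hAc, hAV, hAU, hAm⟩ := hV.exists_iUnion_isClosed
  -- The first piece exhausts `V`; the second makes the capacities converge to that of `V`.
  set K : ℕ → Set X := fun n => (compactCovering X n ∩ A n) ∪ accumulate L n with hKdef
  have hKc : ∀ n, IsCompact (K n) := fun n =>
    ((isCompact_compactCovering X n).inter_right (hAc n)).union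
      ((finite_le_nat n).isCompact_biUnion fun i _ => hLc i)
  have hKV : ∀ n, K n ⊆ V := fun n =>
    union_subset (inter_subset_right.trans (hAV n)) (iUnion₂_subset fun i _ => hLV i)
  have hKm : Monotone K := fun m n hmn => union_subset_union
    (inter_subset_inter (compactCovering_subset X hmn) (hAm hmn)) (monotone_accumulate hmn)
  have hKU : ⋃ n, K n = V := by
    refine subset_antisymm (iUnion_subset hKV) fun z hz => ?_
    obtain ⟨i, hi⟩ := mem_iUnion.1 (hAU.symm.subset hz)
    obtain ⟨j, hj⟩ := exists_mem_compactCovering z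
    exact mem_iUnion.2 ⟨max i j, Or.inl ⟨compactCovering_subset X (le_max_right _ _) hj,
      hAm (le_max_left _ _) hi⟩⟩
  have hlt : ∀ n, u n < maxMass G r (K n) := fun n =>
    (hLu n).trans_le (maxMass_mono ((subset_accumulate).trans subset_union_right))
  have hle : ∀ n, maxMass G r (K n) ≤ innerMass G r V := fun n =>
    maxMass_le_innerMass (hKc n) (hKV n)
  have htend : Tendsto (fun n => maxMass G r (K n) ^ q) atTop (𝓝 (innerMass G r V ^ q)) :=
    (ENNReal.continuous_rpow_const.tendsto _).comp
      (tendsto_of_tendsto_of_tendsto_of_le_of_le hlim tendsto_const_nhds (fun n => (hlt n).le) hle)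
  have hfin : ∀ n, maxMass G r (K n) ≠ ⊤ := fun n => ne_top_of_le_ne_top ht (hle n)
  choose μ hμ hμK using fun n => exists_isEquilibrium_of_isCompact hG hqr (hKc n)
    (bot_le.trans_lt (hlt n)).ne' (hfin n)
  obtain ⟨γ, hγ, hγV⟩ := exists_isEquilibrium_limit hG hqr hKm hμ
    (fun n => ENNReal.rpow_ne_top_of_nonneg hqr.nonneg (hfin n))
    (ENNReal.rpow_ne_top_of_nonneg hqr.nonneg ht) htend
    (by simpa only [rootCap_of_isCompact hG hr (hKc _)] using htend)
    (F := fun _ => closure V) (fun _ => isClosed_closure) (fun _ => Eventually.of_forall fun n =>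
      measure_mono_null (compl_subset_compl.2 ((hKV n).trans subset_closure)) (hμK n))
  rw [hKU] at hγ
  exact ⟨γ, hγ, hγV 0⟩

theorem exists_isEquilibrium (hG : IsKernelFamily G) (hqr : q.HolderConjugate r)
    {E : Set X} (h0 : rootCap G r E ≠ 0) (ht : rootCap G r E ≠ ⊤) :
    ∃ γ, IsEquilibrium G r E (rootCap G r E ^ q) γ ∧ γ (closure E)ᶜ = 0 := by
  -- Confinement to shrinking thickenings forces the limit measure to live on `closure E`. At `n =
  -- 0` the tolerance is `⊤`, and the strict inequality still gives finiteness.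
  have hex : ∀ n : ℕ, ∃ V, IsOpen V ∧ E ⊆ V ∧ V ⊆ Metric.thickening (1 / ((n : ℝ) + 1)) E ∧
      innerMass G r V < rootCap G r E + ((n : ℝ≥0∞))⁻¹ := by
    intro n
    obtain ⟨V, hV, hEV, hlt⟩ := exists_isOpen_of_rootCap_lt
      (ENNReal.lt_add_right ht (ENNReal.inv_ne_zero.2 (ENNReal.natCast_ne_top n)))
    exact ⟨V ∩ Metric.thickening (1 / ((n : ℝ) + 1)) E, hV.inter Metric.isOpen_thickening,
      subset_inter hEV (Metric.self_subset_thickening (by positivity) E), inter_subset_right,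
      (innerMass_mono inter_subset_left).trans_lt hlt⟩
  choose V hV hEV hVt hlt using hex
  have hge : ∀ n, rootCap G r E ≤ innerMass G r (V n) := fun n =>
    rootCap_le_innerMass (hV n) (hEV n)
  have hup : Tendsto (fun n : ℕ => rootCap G r E + ((n : ℝ≥0∞))⁻¹) atTop (𝓝 (rootCap G r E)) := by
    simpa using ENNReal.tendsto_inv_nat_nhds_zero.const_add (rootCap G r E)
  have htend : Tendsto (fun n => innerMass G r (V n) ^ q) atTop (𝓝 (rootCap G r E ^ q)) :=
    (ENNReal.continuous_rpow_const.tendsto _).comp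
      (tendsto_of_tendsto_of_tendsto_of_le_of_le tendsto_const_nhds hup hge fun n => (hlt n).le)
  have hfin : ∀ n, innerMass G r (V n) ≠ ⊤ := fun n => (hlt n).ne_top
  choose μ hμ hμV using fun n => exists_isEquilibrium_of_isOpen hG hqr (hV n)
    (ne_bot_of_le_ne_bot h0 (hge n)) (hfin n)
  obtain ⟨γ, hγ, hγF⟩ := exists_isEquilibrium_limit hG hqr (E := fun _ => E)
    (fun _ _ _ => le_rfl) (fun n => (hμ n).mono (hEV n))
    (fun n => ENNReal.rpow_ne_top_of_nonneg hqr.nonneg (hfin n))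
    (ENNReal.rpow_ne_top_of_nonneg hqr.nonneg ht) htend tendsto_const_nhds
    (F := fun k : ℕ => Metric.cthickening (1 / ((k : ℝ) + 1)) E)
    (fun _ => Metric.isClosed_cthickening) (fun k => by
      filter_upwards [eventually_ge_atTop k] with n hn
      refine measure_mono_null (compl_subset_compl.2 (closure_minimal ((hVt n).trans ?_)
        Metric.isClosed_cthickening)) (hμV n)
      exact (Metric.thickening_subset_cthickening _ _).trans
        (Metric.cthickening_mono (Nat.one_div_le_one_div hn) E))
  rw [iUnion_const] at hγ
  refine ⟨γ, hγ, ?_⟩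
  rw [← iInter_cthickening_one_div, compl_iInter]
  exact measure_iUnion_null hγF

end Equilibrium

end WolffCapacity

/-! ### Transfer to the parabolic dyadic lattice -/

namespace Parabolic

open WolffCapacity

variable {d : ℕ}

theorem Rect.exists_rational_position {R R' : Rect d} (h : R' ∈ R.descendants) :
    ∃ (a : ℚ) (b : Fin d → ℚ) (c : ℚ), a ≠ 0 ∧ R'.side = a * R.side ∧
      (∀ i, R'.x i = R.x i + b i * R.side) ∧ R'.t = R.t + c * R.side ^ 2 := by
  change Relation.ReflTransGen Rect.IsChild R R' at h
  induction h with
  | refl => exact ⟨1, 0, 0, one_ne_zero, by simp, by simp, by simp⟩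
  | @tail S T _ hchild ih =>
    obtain ⟨a, b, c, ha, h1, h2, h3⟩ := ih
    obtain ⟨hs, hx, k, hk⟩ := hchild
    have hb : ∀ i, ∃ β : ℚ, T.x i = R.x i + ((b i + β : ℚ) : ℝ) * R.side := fun i => by
      rcases hx i with h | h
      · refine ⟨-(a / 4), ?_⟩
        rw [h, h2, h1]; push_cast; ring
      · refine ⟨a / 4, ?_⟩
        rw [h, h2, h1]; push_cast; ring
    choose β hβ using hb
    refine ⟨a / 2, fun i => b i + β i, c - (k : ℕ) * (a ^ 2 / 4), by simpa using ha, ?_, hβ, ?_⟩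
    · rw [hs, h1]; push_cast; ring
    · rw [hk, h3, h1]; push_cast; ring

/-- Any rectangle shares an ancestor with a fixed `R₀`, so its side and position relative to `R₀`
are rational parameters that determine it. -/
theorem IsDyadicLattice.countable {Ω : Set (SpaceTime d)} {D : Set (Rect d)}
    (hD : IsDyadicLattice Ω D) : D.Countable := by
  rcases D.eq_empty_or_nonempty with rfl | ⟨R₀, h₀⟩
  · exact countable_empty
  have hpos : ∀ R : D, ∃ p : ℚ × (Fin d → ℚ) × ℚ, R.1.side = p.1 * R₀.side ∧
      (∀ i, R.1.x i = R₀.x i + p.2.1 i * R₀.side) ∧ R.1.t = R₀.t + p.2.2 * R₀.side ^ 2 := by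
    rintro ⟨R, hR⟩
    obtain ⟨S, -, hR', h₀'⟩ := hD.common_ancestor R hR R₀ h₀
    obtain ⟨a, b, c, ha, h1, h2, h3⟩ := Rect.exists_rational_position hR'
    obtain ⟨a', b', c', ha', h1', h2', h3'⟩ := Rect.exists_rational_position h₀'
    have ha'' : (a' : ℝ) ≠ 0 := by exact_mod_cast ha'
    refine ⟨(a / a', fun i => (b i - b' i) / a', (c - c') / a' ^ 2), ?_, fun i => ?_, ?_⟩
    · simp only [h1, h1']; push_cast; field_simp
    · simp only [h2, h2', h1']; push_cast; field_simp; ring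
    · simp only [h3, h3', h1']; push_cast; field_simp; ring
  choose p hp1 hp2 hp3 using hpos
  have hinj : Function.Injective p := by
    rintro ⟨⟨x, t, s, hs⟩, hR⟩ ⟨⟨x', t', s', hs'⟩, hR'⟩ h
    have e1 := hp1 ⟨⟨x, t, s, hs⟩, hR⟩
    have e2 := hp2 ⟨⟨x, t, s, hs⟩, hR⟩
    have e3 := hp3 ⟨⟨x, t, s, hs⟩, hR⟩
    rw [h, ← hp1] at e1
    rw [h, ← hp3] at e3
    have e2' : x = x' := by
      ext i
      have := e2 i
      rw [h, ← hp2] at this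
      exact this
    simp only [Subtype.mk.injEq, Rect.mk.injEq]
    exact ⟨e2', e3, e1⟩
  exact countable_coe_iff.1 hinj.countable

/-- The cut-off functions, normalized so that the Wolff potential has constant coefficients. -/
noncomputable def kernel (D : Set (Rect d)) (η : Rect d → SpaceTime d → ℝ) (α q : ℝ)
    (R : {R : Rect d // R ∈ D ∧ R.side < 1}) (z : SpaceTime d) : ℝ :=
  (R.1.side ^ (α * q - ((d : ℝ) + 2))) ^ (1 / q) * η R.1 z

variable {D : Set (Rect d)} {η : Rect d → SpaceTime d → ℝ} {α q : ℝ}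

theorem IsCutoffFamily.nonneg (hη : IsCutoffFamily D η) {R : Rect d} (hR : R ∈ D)
    (z : SpaceTime d) : 0 ≤ η R z :=
  (indicator_nonneg (fun _ _ => zero_le_one) z).trans (hη.indicator_le R hR z)

theorem isKernelFamily_kernel (hη : IsCutoffFamily D η) : IsKernelFamily (kernel D η α q) where
  continuous R := continuous_const.mul (hη.contDiff R.1 R.2.1).continuous
  hasCompactSupport R := (hη.hasCompactSupport R.1 R.2.1).mul_left
  nonneg R z := mul_nonneg (Real.rpow_nonneg (Real.rpow_nonneg R.1.side_pos.le _) _)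
    (hη.nonneg R.2.1 z)

/-- The weight enters once through the kernel and with power $r-1$ through the coefficient, for a
total exponent $r/q=r-1$. -/
theorem wolffPotential_eq_pot (hq : 1 < q) (μ : Measure (SpaceTime d)) :
    wolffPotential D η α q μ = pot (kernel D η α q) (q / (q - 1)) μ := by
  have hr : 0 ≤ q / (q - 1) - 1 := by
    rw [sub_nonneg, one_le_div (by linarith)]; linarith
  funext z
  refine tsum_congr fun R => ?_
  have hside := Real.rpow_pos_of_pos R.1.side_pos (α * q - ((d : ℝ) + 2))
  have hc := Real.rpow_pos_of_pos hside (1 / q)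
  have hcoeff : coeff (kernel D η α q) μ R =
      ENNReal.ofReal ((R.1.side ^ (α * q - ((d : ℝ) + 2))) ^ (1 / q)) *
        ∫⁻ w, ENNReal.ofReal (η R.1 w) ∂μ := by
    simp only [coeff, kernel, ENNReal.ofReal_mul hc.le]
    exact lintegral_const_mul' _ _ ENNReal.ofReal_ne_top
  beta_reduce
  rw [hcoeff, kernel, ENNReal.ofReal_mul hc.le, ENNReal.mul_rpow_of_nonneg _ _ hr,
    ENNReal.mul_rpow_of_nonneg _ _ hr, ENNReal.ofReal_rpow_of_pos hc, ENNReal.ofReal_rpow_of_pos hside,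
    mul_mul_mul_comm, ← ENNReal.ofReal_mul (by positivity), ← Real.rpow_mul hside.le,
    ← Real.rpow_add hside, mul_assoc]
  congr 3
  have : q - 1 ≠ 0 := by linarith
  field_simp
  ring

theorem energy_eq_energy (hq : 1 < q) (μ : Measure (SpaceTime d)) :
    energy D η α q μ = WolffCapacity.energy (kernel D η α q) (q / (q - 1)) μ := by
  rw [energy, wolffPotential_eq_pot hq]; rfl

theorem compactCapacity_eq (hq : 1 < q) (K : Set (SpaceTime d)) :
    compactCapacity D η α q K = maxMass (kernel D η α q) (q / (q - 1)) K ^ q := by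
  simp only [compactCapacity, maxMass, energy_eq_energy hq]

theorem capacity_eq (hq : 1 < q) (E : Set (SpaceTime d)) :
    capacity D η α q E = rootCap (kernel D η α q) (q / (q - 1)) E ^ q := by
  -- As an order isomorphism, the power commutes with suprema and infima.
  have h : ∀ x : ℝ≥0∞, x ^ q = ENNReal.orderIsoRpow q (by linarith) x := fun _ => rfl
  simp only [capacity, rootCap, innerMass, compactCapacity_eq hq, h, OrderIso.map_iInf,
    OrderIso.map_iSup]

theorem isCapacitaryMeasure_of_isEquilibrium (hq : 1 < q) {E : Set (SpaceTime d)}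
    {γ : Measure (SpaceTime d)}
    (h : IsEquilibrium (kernel D η α q) (q / (q - 1)) E
      (rootCap (kernel D η α q) (q / (q - 1)) E ^ q) γ) (hE : γ (closure E)ᶜ = 0) :
    IsCapacitaryMeasure D η α q E γ where
  isLocallyFinite := h.isLocallyFinite
  support_subset := Measure.support_subset_of_isClosed isClosed_closure hE
  mass_eq := by
    rw [capacity_eq hq, ← h.mass]
    exact measure_congr (by simpa [Filter.eventuallyEq_univ] using hE)
  one_le_quasi_everywhere := by
    rw [capacity_eq hq, wolffPotential_eq_pot hq, h.one_le, ENNReal.zero_rpow_of_pos (by linarith)]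
  le_one_on_support := by
    rw [wolffPotential_eq_pot hq]; exact h.le_one

end Parabolic

/-! ### The theorem -/

open Parabolic in
theorem theorem4p4 (d : ℕ) (hd : 2 ≤ d)
    (α q : ℝ) (hα : 0 < α) (hαn : α < (d : ℝ) + 2) (hq : 1 < q) (hqn : q ≤ ((d : ℝ) + 2) / α)
    (Ω : Set (SpaceTime d)) (hΩ : Ω = Set.univ ∨ Ω = {z | 0 < z.2})
    (D : Set (Rect d)) (hD : IsDyadicLattice Ω D)
    (η : Rect d → SpaceTime d → ℝ) (hη : IsCutoffFamily D η) :
    (∀ K : Set (SpaceTime d), IsCompact K →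
      0 < compactCapacity D η α q K → compactCapacity D η α q K < ⊤ →
      ∃ γ : MeasureTheory.Measure (SpaceTime d),
        IsCapacitaryMeasure D η α q K γ ∧ γ.support ⊆ K ∧
          γ K = compactCapacity D η α q K) ∧
    (∀ E : Set (SpaceTime d),
      0 < capacity D η α q E → capacity D η α q E < ⊤ →
      ∃ γ : MeasureTheory.Measure (SpaceTime d), IsCapacitaryMeasure D η α q E γ) := by
  have hq0 : 0 < q := by linarith
  have hqr : q.HolderConjugate (q / (q - 1)) := Real.HolderConjugate.conjExponent hq
  have hG := isKernelFamily_kernel (α := α) (q := q) hη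
  have : Countable {R : Rect d // R ∈ D ∧ R.side < 1} :=
    countable_coe_iff.2 (hD.countable.mono fun R hR => hR.1)
  have ne0 : ∀ x : ℝ≥0∞, 0 < x ^ q → x ≠ 0 := fun x h hx => by
    simp [hx, hq0] at h
  have net : ∀ x : ℝ≥0∞, x ^ q < ⊤ → x ≠ ⊤ := fun x h hx => by
    simp [hx, hq0] at h
  refine ⟨fun K hK h0 ht => ?_, fun E h0 ht => ?_⟩
  · rw [compactCapacity_eq hq] at h0 ht
    obtain ⟨γ, hγ, hγK⟩ := WolffCapacity.exists_isEquilibrium_of_isCompact hG hqr hK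
      (ne0 _ h0) (net _ ht)
    rw [← WolffCapacity.rootCap_of_isCompact hG hqr.symm.lt hK] at hγ
    have hcap := isCapacitaryMeasure_of_isEquilibrium hq hγ
      (by rwa [hK.isClosed.closure_eq])
    refine ⟨γ, hcap, ?_, ?_⟩
    · simpa only [hK.isClosed.closure_eq] using hcap.support_subset
    · have := hcap.mass_eq
      rwa [hK.isClosed.closure_eq, capacity_eq hq,
        WolffCapacity.rootCap_of_isCompact hG hqr.symm.lt hK, ← compactCapacity_eq hq] at this
  · rw [capacity_eq hq] at h0 ht
    obtain ⟨γ, hγ, hγE⟩ := WolffCapacity.exists_isEquilibrium hG hqr (ne0 _ h0) (net _ ht)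
    exact ⟨γ, isCapacitaryMeasure_of_isEquilibrium hq hγ hγE⟩
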